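/- Theorem. For a stable $n$-legged tree $\Gamma$ (a finite tree with legs labelled $1,\dots,n$ attached to its vertices such that at every vertex the number of incident edges plus the number of incident legs is at least $3$) let $\overline{C(\Gamma)}=\mathbb{R}_{\ge 0}^{E(\Gamma)}$, with its standard integral structure. Let $M_{0,n}^{\mathrm{trop}}$ be the cone complex obtained by glueing the cones $\overline{C(\Gamma)}$, over all stable $n$-legged trees $\Gamma$, along specializations: whenever $\Gamma'$ is isomorphic to the legged tree $\Gamma/S$ obtained from $\Gamma$ by contracting a set $S$ of edges, $\overline{C(\Gamma')}$ is identified with the face of $\overline{C(\Gamma)}$ where the coordinates in $S$ vanish. Let $\overline{M}_{0,n}^{\mathrm{trop}}$ be the extended cone complex obtained in the same way from the extended cones $(\mathbb{R}_{\ge 0}\cup\{\infty\})^{E(\Gamma)}$. A morphism of (extended) cone complexes is a continuous map whose restriction to each (extended) cone factors through a morphism to some (extended) cone; here a morphism of cones is a continuous map that pulls back integral linear functions to integral linear functions, and a morphism of extended cones is a continuous map whose restriction to the finite part $\mathbb{R}_{\ge0}^{E}$ is a morphism of cones to a face (possibly at infinity) of the target. An automorphism is a morphism from the complex to itself that has an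 inverse which is also a morphism. The group $S_n$ acts on both complexes by permutation of the legs, preserving the edge lengths. (1) If $n\ge 5$, the resulting homomorphisms $S_n\to \mathrm{Aut}(M_{0,n}^{\mathrm{trop}})$ and $S_n\to\mathrm{Aut}(\overline{M}_{0,n}^{\mathrm{trop}})$ are isomorphisms. In particular both automorphism groups are isomorphic to $S_n$ and every automorphism is induced by a permutation of the legs. (2) If $n=4$, then $\mathrm{Aut}(M_{0,4}^{\mathrm{trop}})\cong S_3$ and $\mathrm{Aut}(\overline{M}_{0,4}^{\mathrm{trop}})\cong S_3$; the resulting homomorphisms from $S_4$ to these groups are surjective with kernel the Klein four-group $\{(),(12)(34),(13)(24),(14)(23)\}$. -/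

import Mathlib

open scoped NNReal ENNReal

noncomputable section

namespace TropModuli

/-! ### Stable legged trees and their contractions -/

/-- A stable `n`-legged tree: a finite tree, legs indexed by `Fin n` attached to its vertices, and
`val(v) + l(v) ≥ 3` at every vertex `v`. Since only isomorphism classes matter for the moduli
spaces, the vertex set is taken to be of the form `Fin k`. -/
structure StableTree (n : ℕ) where
  /-- the number of vertices -/
  k : ℕ
  /-- the underlying graph -/
  graph : SimpleGraph (Fin k)
  isTree : graph.IsTree
  /-- the vertex to which a leg is attached -/
  leg : Fin n → Fin k
  stable : ∀ v, 3 ≤ (graph.incidenceSet v).ncard + (leg ⁻¹' {v}).ncard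

/-- The set of edges `E(Γ)`. -/
def StableTree.Edge {n : ℕ} (Γ : StableTree n) : Type :=
  {e : Sym2 (Fin Γ.k) // e ∈ Γ.graph.edgeSet}

instance {n : ℕ} (Γ : StableTree n) : Finite Γ.Edge :=
  inferInstanceAs (Finite {e : Sym2 (Fin Γ.k) // e ∈ Γ.graph.edgeSet})

instance {n : ℕ} (Γ : StableTree n) : Fintype Γ.Edge := Fintype.ofFinite _

/-- A specialization of `Γ` to `Γ'`, that is, an identification of `Γ'` with the legged tree
`Γ/S` obtained from `Γ` by contracting a set `S` of edges. It is recorded as the quotient map on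
vertices: its fibres span connected subgraphs of `Γ`, the edges of `Γ'` are the images of the edges
of `Γ` between different fibres, and legs go to legs. The contracted set `S` consists of the edges
of `Γ` lying inside a fibre; `S = ∅` gives the isomorphisms of legged trees. -/
structure Contraction {n : ℕ} (Γ Γ' : StableTree n) where
  /-- the map on vertices -/
  toFun : Fin Γ.k → Fin Γ'.k
  map_leg : ∀ i, toFun (Γ.leg i) = Γ'.leg i
  connected_fiber : ∀ w, (Γ.graph.induce (toFun ⁻¹' {w})).Connected
  adj_iff : ∀ x y, Γ'.graph.Adj x y ↔
    x ≠ y ∧ ∃ v w, toFun v = x ∧ toFun w = y ∧ Γ.graph.Adj v w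

open Classical in
/-- Extension by zero of a length function on `Γ' = Γ/S` to `Γ`: contracted edges get length `0`,
each other edge gets the length of its image. This is the inclusion of the (extended) cone of `Γ'`
as a face of the (extended) cone of `Γ`. -/
def Contraction.extend {n : ℕ} {Γ Γ' : StableTree n} (c : Contraction Γ Γ') {R : Type} [Zero R]
    (x : Γ'.Edge → R) : Γ.Edge → R :=
  fun e => if h : Sym2.map c.toFun e.1 ∈ Γ'.graph.edgeSet then x ⟨_, h⟩ else 0

/-! ### The moduli spaces -/

/-- The glueing relation on the disjoint union of the cones `R ^ E(Γ)`: if `Γ` specializes to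
`Γ'`, a point of the cone of `Γ'` is identified with its image in the cone of `Γ`. -/
def Glue (R : Type) [Zero R] (n : ℕ) (p q : Σ Γ : StableTree n, Γ.Edge → R) : Prop :=
  ∃ c : Contraction q.1 p.1, q.2 = c.extend p.2

/-- The space obtained from the disjoint union of the cones `R ^ E(Γ)`, over all stable `n`-legged
trees `Γ`, by glueing along specializations (the quotient by the equivalence relation generated by
`Glue`). -/
def Moduli (R : Type) [Zero R] (n : ℕ) : Type := Quot (Glue R n)

/-- The quotient topology of the disjoint union of the cones. -/
instance (R : Type) [Zero R] [TopologicalSpace R] (n : ℕ) : TopologicalSpace (Moduli R n) :=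
  inferInstanceAs (TopologicalSpace (Quot (Glue R n)))

/-- The inclusion of the (extended) cone of `Γ` in the moduli space. -/
def Moduli.mk {R : Type} [Zero R] {n : ℕ} (Γ : StableTree n) (x : Γ.Edge → R) : Moduli R n :=
  Quot.mk (Glue R n) ⟨Γ, x⟩

/-- `M_{0,n}^trop`, glued from the cones `ℝ_{≥0} ^ E(Γ)`. -/
abbrev MTrop (n : ℕ) : Type := Moduli ℝ≥0 n

/-- The compactification of `M_{0,n}^trop`, glued from the extended cones
`(ℝ_{≥0} ∪ {∞}) ^ E(Γ)`. -/
abbrev MTropBar (n : ℕ) : Type := Moduli ℝ≥0∞ n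

/-! ### Morphisms of cones and of extended cones -/

/-- Membership in the lattice `M` of integral linear functions on the cone `ℝ_{≥0} ^ E`. -/
def IsIntegralLinear {E : Type} [Fintype E] (u : (E → ℝ≥0) → ℝ) : Prop :=
  ∃ a : E → ℤ, ∀ x, u x = ∑ e, (a e : ℝ) * (x e : ℝ)

/-- A morphism of cones (with integral structure) `ℝ_{≥0} ^ E → ℝ_{≥0} ^ E'`: a continuous map
that pulls back integral linear functions to integral linear functions. -/
def IsConeMorphism {E E' : Type} [Fintype E] [Fintype E'] (φ : (E → ℝ≥0) → (E' → ℝ≥0)) : Prop :=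
  Continuous φ ∧ ∀ u : (E' → ℝ≥0) → ℝ, IsIntegralLinear u → IsIntegralLinear (u ∘ φ)

open Classical in
/-- A morphism of extended cones `(ℝ_{≥0} ∪ {∞}) ^ E → (ℝ_{≥0} ∪ {∞}) ^ E'`: a continuous map whose
restriction to the cone `ℝ_{≥0} ^ E` is a morphism of cones to a (possibly infinite) face of the
target. The faces at infinity correspond to the subsets `S` of `E'`: the face of `S` consists of the
`y` with `y e' = ∞` exactly for `e' ∈ S`, and is the cone `ℝ_{≥0} ^ (E' \ S)`. -/
def IsExtConeMorphism {E E' : Type} [Fintype E] [Fintype E']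
    (φ : (E → ℝ≥0∞) → (E' → ℝ≥0∞)) : Prop :=
  Continuous φ ∧ ∃ (S : Finset E') (g : (E → ℝ≥0) → ({e' : E' // e' ∉ S} → ℝ≥0)),
    IsConeMorphism g ∧ ∀ (x : E → ℝ≥0) (e' : E'),
      φ (fun e => (x e : ℝ≥0∞)) e' = if h : e' ∈ S then ⊤ else (g x ⟨e', h⟩ : ℝ≥0∞)

/-! ### Morphisms of (extended) cone complexes -/

/-- A map of cone complexes `M_{0,n}^trop → M_{0,n}^trop`: a continuous map whose restriction to
each cone factors through a morphism of cones to some cone. -/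
def IsConeComplexMap {n : ℕ} (f : MTrop n → MTrop n) : Prop :=
  Continuous f ∧ ∀ Γ : StableTree n, ∃ (Γ' : StableTree n) (φ : (Γ.Edge → ℝ≥0) → (Γ'.Edge → ℝ≥0)),
    IsConeMorphism φ ∧ ∀ x, f (Moduli.mk Γ x) = Moduli.mk Γ' (φ x)

/-- A morphism of extended cone complexes from the compactification of `M_{0,n}^trop` to itself:
a continuous map whose restriction to each extended cone factors through a morphism of extended
cones to some extended cone. -/
def IsExtConeComplexMap {n : ℕ} (f : MTropBar n → MTropBar n) : Prop :=
  Continuous f ∧ ∀ Γ : StableTree n,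
    ∃ (Γ' : StableTree n) (φ : (Γ.Edge → ℝ≥0∞) → (Γ'.Edge → ℝ≥0∞)),
      IsExtConeMorphism φ ∧ ∀ x, f (Moduli.mk Γ x) = Moduli.mk Γ' (φ x)

/-! ### Identities and composition -/

theorem isConeMorphism_id {E : Type} [Fintype E] :
    IsConeMorphism (fun x : E → ℝ≥0 => x) :=
  ⟨continuous_id, fun _ hu => hu⟩

theorem IsConeMorphism.comp {E E' E'' : Type} [Fintype E] [Fintype E'] [Fintype E'']
    {ψ : (E' → ℝ≥0) → (E'' → ℝ≥0)} {φ : (E → ℝ≥0) → (E' → ℝ≥0)}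
    (hψ : IsConeMorphism ψ) (hφ : IsConeMorphism φ) : IsConeMorphism (ψ ∘ φ) :=
  ⟨hψ.1.comp hφ.1, fun u hu => hφ.2 _ (hψ.2 u hu)⟩

/-- Morphisms of cones are given by matrices of natural numbers. -/
theorem isConeMorphism_iff {E E' : Type} [Fintype E] [Fintype E']
    {φ : (E → ℝ≥0) → (E' → ℝ≥0)} :
    IsConeMorphism φ ↔ ∃ T : E' → E → ℕ, ∀ x e', φ x e' = ∑ e, (T e' e : ℝ≥0) * x e := by
  classical
  constructor
  · rintro ⟨-, h⟩
    have key : ∀ e', ∃ a : E → ℕ, ∀ x, φ x e' = ∑ e, (a e : ℝ≥0) * x e := by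
      intro e'
      obtain ⟨a, ha⟩ := h (fun y => (y e' : ℝ))
        ⟨fun e => if e = e' then 1 else 0, fun x => by simp⟩
      have hpos : ∀ e, 0 ≤ a e := by
        intro e
        have h1 := ha (fun i => if i = e then 1 else 0)
        simp only [Function.comp_apply] at h1
        have h2 : (0 : ℝ) ≤ a e := by
          have h3 := NNReal.coe_nonneg (φ (fun i => if i = e then 1 else 0) e')
          rw [h1, Finset.sum_eq_single e (fun i _ hi => by simp [hi]) (by simp)] at h3
          simpa using h3
        exact_mod_cast h2
      refine ⟨fun e => (a e).toNat, fun x => ?_⟩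
      have h1 := ha x
      apply NNReal.coe_injective
      simp only [Function.comp_apply] at h1
      rw [h1]
      push_cast
      refine Finset.sum_congr rfl fun e _ => ?_
      congr 1
      have := Int.toNat_of_nonneg (hpos e)
      exact_mod_cast this.symm
    choose T hT using key
    exact ⟨T, fun x e' => hT e' x⟩
  · rintro ⟨T, hT⟩
    refine ⟨?_, ?_⟩
    · refine continuous_pi fun e' => ?_
      simp only [hT]
      fun_prop
    · rintro u ⟨a, ha⟩
      refine ⟨fun e => ∑ e', a e' * T e' e, fun x => ?_⟩
      simp only [Function.comp_apply, ha, hT]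
      push_cast
      simp only [Finset.mul_sum, Finset.sum_mul]
      rw [Finset.sum_comm]
      simp only [mul_assoc]

theorem denseRange_coe_pi (E : Type) :
    DenseRange (fun (x : E → ℝ≥0) (e : E) => (x e : ℝ≥0∞)) := by
  have h : DenseRange ((↑) : ℝ≥0 → ℝ≥0∞) := by
    have h1 : Set.range ((↑) : ℝ≥0 → ℝ≥0∞) = {⊤}ᶜ := by
      ext x
      exact WithTop.ne_top_iff_exists.symm
    rw [DenseRange, h1]
    exact dense_compl_singleton _
  exact DenseRange.piMap (fun _ => h)

theorem continuous_natMatrix {E : Type} [Fintype E] (a : E → ℕ) :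
    Continuous fun x : E → ℝ≥0∞ => ∑ e, (a e : ℝ≥0∞) * x e :=
  continuous_finsetSum _ fun e _ =>
    (ENNReal.continuous_const_mul (ENNReal.natCast_ne_top _)).comp (continuous_apply e)

open Classical in
/-- Morphisms of extended cones are given, outside a set of coordinates that are constantly `∞`,
by matrices of natural numbers. -/
theorem isExtConeMorphism_iff {E E' : Type} [Fintype E] [Fintype E']
    {φ : (E → ℝ≥0∞) → (E' → ℝ≥0∞)} :
    IsExtConeMorphism φ ↔ ∃ (S : Finset E') (T : E' → E → ℕ), ∀ x e',
      φ x e' = if e' ∈ S then ⊤ else ∑ e, (T e' e : ℝ≥0∞) * x e := by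
  constructor
  · rintro ⟨hc, S, g, hg, h⟩
    obtain ⟨T, hT⟩ := isConeMorphism_iff.1 hg
    refine ⟨S, fun e' e => if h : e' ∈ S then 0 else T ⟨e', h⟩ e, fun x e' => ?_⟩
    revert x
    rw [← funext_iff]
    refine (denseRange_coe_pi E).equalizer ((continuous_apply e').comp hc) ?_ ?_
    · split_ifs
      · exact continuous_const
      · exact continuous_natMatrix _
    · funext x
      simp only [Function.comp_apply, h]
      split_ifs with hS
      · rfl
      · simp [hT]
  · rintro ⟨S, T, h⟩
    refine ⟨?_, S, fun x e' => ∑ e, (T e'.1 e : ℝ≥0) * x e, ?_, ?_⟩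
    · refine continuous_pi fun e' => ?_
      simp only [h]
      split_ifs
      · exact continuous_const
      · exact continuous_natMatrix _
    · exact isConeMorphism_iff.2 ⟨fun e' e => T e'.1 e, fun _ _ => rfl⟩
    · intro x e'
      rw [h]
      split_ifs with hS
      · rfl
      · simp

theorem isExtConeMorphism_id {E : Type} [Fintype E] :
    IsExtConeMorphism (fun x : E → ℝ≥0∞ => x) := by
  classical
  exact isExtConeMorphism_iff.2 ⟨∅, fun e' e => if e = e' then 1 else 0, fun x e' => by simp⟩

theorem IsExtConeMorphism.comp {E E' E'' : Type} [Fintype E] [Fintype E'] [Fintype E'']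
    {ψ : (E' → ℝ≥0∞) → (E'' → ℝ≥0∞)} {φ : (E → ℝ≥0∞) → (E' → ℝ≥0∞)}
    (hψ : IsExtConeMorphism ψ) (hφ : IsExtConeMorphism φ) : IsExtConeMorphism (ψ ∘ φ) := by
  classical
  obtain ⟨S, T, hT⟩ := isExtConeMorphism_iff.1 hφ
  obtain ⟨S', T', hT'⟩ := isExtConeMorphism_iff.1 hψ
  refine isExtConeMorphism_iff.2
    ⟨S' ∪ Finset.univ.filter (fun e'' => ∃ e' ∈ S, T' e'' e' ≠ 0),
      fun e'' e => ∑ e', T' e'' e' * T e' e, fun x e'' => ?_⟩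
  simp only [Function.comp_apply, hT', Finset.mem_union, Finset.mem_filter, Finset.mem_univ,
    true_and]
  by_cases h1 : e'' ∈ S'
  · simp [h1]
  by_cases h2 : ∃ e' ∈ S, T' e'' e' ≠ 0
  · rw [if_neg h1, if_pos (Or.inr h2)]
    obtain ⟨e', he', h0⟩ := h2
    refine ENNReal.sum_eq_top.2 ⟨e', Finset.mem_univ _, ?_⟩
    rw [hT, if_pos he', ENNReal.mul_top]
    exact_mod_cast h0
  · rw [if_neg h1, if_neg (not_or.2 ⟨h1, h2⟩)]
    push Not at h2
    push_cast
    simp only [Finset.sum_mul]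
    rw [Finset.sum_comm]
    refine Finset.sum_congr rfl fun e' _ => ?_
    by_cases hS : e' ∈ S
    · simp [h2 e' hS]
    · rw [hT, if_neg hS, Finset.mul_sum]
      simp only [mul_assoc]

theorem isConeComplexMap_id (n : ℕ) : IsConeComplexMap (id : MTrop n → MTrop n) :=
  ⟨continuous_id, fun Γ => ⟨Γ, fun x => x, isConeMorphism_id, fun _ => rfl⟩⟩

theorem IsConeComplexMap.comp {n : ℕ} {f g : MTrop n → MTrop n}
    (hf : IsConeComplexMap f) (hg : IsConeComplexMap g) : IsConeComplexMap (f ∘ g) := by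
  refine ⟨hf.1.comp hg.1, fun Γ => ?_⟩
  obtain ⟨Γ', φ, hφ, h⟩ := hg.2 Γ
  obtain ⟨Γ'', ψ, hψ, h'⟩ := hf.2 Γ'
  exact ⟨Γ'', ψ ∘ φ, hψ.comp hφ, fun x => by simp [h, h']⟩

theorem isExtConeComplexMap_id (n : ℕ) : IsExtConeComplexMap (id : MTropBar n → MTropBar n) :=
  ⟨continuous_id, fun Γ => ⟨Γ, fun x => x, isExtConeMorphism_id, fun _ => rfl⟩⟩

theorem IsExtConeComplexMap.comp {n : ℕ} {f g : MTropBar n → MTropBar n}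
    (hf : IsExtConeComplexMap f) (hg : IsExtConeComplexMap g) : IsExtConeComplexMap (f ∘ g) := by
  refine ⟨hf.1.comp hg.1, fun Γ => ?_⟩
  obtain ⟨Γ', φ, hφ, h⟩ := hg.2 Γ
  obtain ⟨Γ'', ψ, hψ, h'⟩ := hf.2 Γ'
  exact ⟨Γ'', ψ ∘ φ, hψ.comp hφ, fun x => by simp [h, h']⟩

/-! ### The automorphism groups -/

/-- The automorphism group of `M_{0,n}^trop`: the maps of cone complexes with an inverse that is
also a map of cone complexes. -/
def AutMTrop (n : ℕ) : Subgroup (Equiv.Perm (MTrop n)) where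
  carrier := {f | IsConeComplexMap (f : MTrop n → MTrop n) ∧
    IsConeComplexMap (f.symm : MTrop n → MTrop n)}
  mul_mem' := fun hf hg => ⟨hf.1.comp hg.1, hg.2.comp hf.2⟩
  one_mem' := ⟨isConeComplexMap_id n, isConeComplexMap_id n⟩
  inv_mem' := fun hf => ⟨hf.2, hf.1⟩

/-- The automorphism group of the compactification of `M_{0,n}^trop`: the morphisms of extended cone
complexes with an inverse that is also a morphism of extended cone complexes. -/
def AutMTropBar (n : ℕ) : Subgroup (Equiv.Perm (MTropBar n)) where
  carrier := {f | IsExtConeComplexMap (f : MTropBar n → MTropBar n) ∧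
    IsExtConeComplexMap (f.symm : MTropBar n → MTropBar n)}
  mul_mem' := fun hf hg => ⟨hf.1.comp hg.1, hg.2.comp hf.2⟩
  one_mem' := ⟨isExtConeComplexMap_id n, isExtConeComplexMap_id n⟩
  inv_mem' := fun hf => ⟨hf.2, hf.1⟩

/-! ### The action of permutations of the legs -/

/-- The legged tree `σ(Γ)`: the same underlying tree, with leg map `leg_Γ ∘ σ⁻¹`. -/
def StableTree.permute {n : ℕ} (σ : Equiv.Perm (Fin n)) (Γ : StableTree n) : StableTree n where
  k := Γ.k
  graph := Γ.graph
  isTree := Γ.isTree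
  leg := Γ.leg ∘ σ.symm
  stable := fun v => by
    have h : (Γ.leg ∘ σ.symm) ⁻¹' {v} = σ '' (Γ.leg ⁻¹' {v}) := by
      rw [Set.preimage_comp, Equiv.image_eq_preimage_symm]
    rw [h, Set.ncard_image_of_injective _ σ.injective]
    exact Γ.stable v

/-- The contraction `σ(Γ) → σ(Γ')` with the same vertex map as a contraction `Γ → Γ'`. -/
def Contraction.permute {n : ℕ} (σ : Equiv.Perm (Fin n)) {Γ Γ' : StableTree n}
    (c : Contraction Γ Γ') : Contraction (Γ.permute σ) (Γ'.permute σ) where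
  toFun := c.toFun
  map_leg := fun i => c.map_leg (σ.symm i)
  connected_fiber := c.connected_fiber
  adj_iff := c.adj_iff

/-- The self-map of the moduli space that sends `Γ` to `σ(Γ)` and preserves the lengths of the
edges. -/
def permuteMap (R : Type) [Zero R] {n : ℕ} (σ : Equiv.Perm (Fin n)) : Moduli R n → Moduli R n :=
  Quot.lift (fun p => Moduli.mk (p.1.permute σ) p.2) (by
    rintro p q ⟨c, hc⟩
    exact Quot.sound ⟨c.permute σ, hc⟩)

theorem permuteMap_one (R : Type) [Zero R] (n : ℕ) :
    permuteMap R (1 : Equiv.Perm (Fin n)) = id := by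
  funext p
  induction p using Quot.ind
  rfl

theorem permuteMap_mul (R : Type) [Zero R] {n : ℕ} (σ τ : Equiv.Perm (Fin n)) :
    permuteMap R (σ * τ) = permuteMap R σ ∘ permuteMap R τ := by
  funext p
  induction p using Quot.ind
  rfl

theorem continuous_permuteMap (R : Type) [Zero R] [TopologicalSpace R] {n : ℕ}
    (σ : Equiv.Perm (Fin n)) : Continuous (permuteMap R σ) := by
  refine continuous_quot_lift _ (continuous_sigma fun Γ => ?_)
  exact continuous_quot_mk.comp
    (continuous_sigmaMk (σ := fun Γ : StableTree n => Γ.Edge → R) (i := Γ.permute σ))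

theorem isConeComplexMap_permuteMap {n : ℕ} (σ : Equiv.Perm (Fin n)) :
    IsConeComplexMap (permuteMap ℝ≥0 σ) :=
  ⟨continuous_permuteMap _ σ, fun Γ => ⟨Γ.permute σ, fun x => x,
    isConeMorphism_id (E := Γ.Edge), fun _ => rfl⟩⟩

theorem isExtConeComplexMap_permuteMap {n : ℕ} (σ : Equiv.Perm (Fin n)) :
    IsExtConeComplexMap (permuteMap ℝ≥0∞ σ) :=
  ⟨continuous_permuteMap _ σ, fun Γ => ⟨Γ.permute σ, fun x => x,
    isExtConeMorphism_id (E := Γ.Edge), fun _ => rfl⟩⟩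

/-- `permuteMap` as a group homomorphism from `S_n` to the permutations of the moduli space. -/
def permuteHom (R : Type) [Zero R] (n : ℕ) : Equiv.Perm (Fin n) →* Equiv.Perm (Moduli R n) where
  toFun σ :=
    { toFun := permuteMap R σ
      invFun := permuteMap R σ⁻¹
      left_inv := fun p => by
        rw [← Function.comp_apply (f := permuteMap R σ⁻¹), ← permuteMap_mul, inv_mul_cancel,
          permuteMap_one, id]
      right_inv := fun p => by
        rw [← Function.comp_apply (f := permuteMap R σ), ← permuteMap_mul, mul_inv_cancel,
          permuteMap_one, id] }
  map_one' := Equiv.ext fun p => congrFun (permuteMap_one R n) p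
  map_mul' σ τ := Equiv.ext fun p => congrFun (permuteMap_mul R σ τ) p

/-- The homomorphism from `S_n` to the automorphism group of `M_{0,n}^trop`, by permutation of the
legs. -/
def legAction (n : ℕ) : Equiv.Perm (Fin n) →* AutMTrop n :=
  (permuteHom ℝ≥0 n).codRestrict (AutMTrop n) fun σ =>
    ⟨isConeComplexMap_permuteMap σ, isConeComplexMap_permuteMap σ⁻¹⟩

/-- The homomorphism from `S_n` to the automorphism group of the compactification of
`M_{0,n}^trop`, by permutation of the legs. -/
def legActionBar (n : ℕ) : Equiv.Perm (Fin n) →* AutMTropBar n :=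
  (permuteHom ℝ≥0∞ n).codRestrict (AutMTropBar n) fun σ =>
    ⟨isExtConeComplexMap_permuteMap σ, isExtConeComplexMap_permuteMap σ⁻¹⟩

/-- The Klein four-group in `S_4` (on the letters `0, 1, 2, 3`). -/
def kleinFour : Set (Equiv.Perm (Fin 4)) :=
  {1, Equiv.swap 0 1 * Equiv.swap 2 3, Equiv.swap 0 2 * Equiv.swap 1 3,
    Equiv.swap 0 3 * Equiv.swap 1 2}

end TropModuli

end

/-! A point of either space is a weight function on splits, the partitions of the legs into two
parts of at least two elements. Each edge of a stable tree induces a split, contraction preserves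
the splits of the surviving edges, and a tree is recovered from its set of splits
(`StableTree.nonempty_contraction`). Hence the weights determine the point
(`Moduli.weight_injective`). The rays correspond to the splits, and two distinct splits occur in one
tree exactly when they are compatible (`StableTree.compat_split`, `exists_tree_of_compat`).

An automorphism is given on each cone by a matrix over `ℕ`; for the extended complex, faces at
infinity are excluded by following the apex (`IsExtConeComplexMap.isNatLinear`). The inverse has
natural entries too, and a unit vector is not a sum of two nonzero vectors over `ℕ`, so the ray
generators are permuted (`IsNatLinear.exists_perm`). This permutation respects compatibility and, by
linearity, determines the automorphism (`IsNatLinear.ext`).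

What remains is the symmetry of the compatibility graph. For `n ≥ 5`, the splits with a two-element
part are recognised by their links not being joins (`linkIsJoin_of_forall_ne`,
`Pair.not_linkIsJoin`). Two of them are compatible exactly when the pairs are equal or disjoint, so
a symmetry permutes the pairs and preserves disjointness; it maps stars to stars and hence comes
from a permutation of the legs. Any other split is determined by the pair splits compatible with it.
For `n = 4` there are three splits, on which `S_4` acts through `S_3` with the Klein four-group as
kernel. -/

namespace TropModuli

/-! ### Cuts of trees -/

section Cuts

variable {V : Type} {G : SimpleGraph V}

/-- A two-colouring of the vertices that changes exactly along the edge `e`. -/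
def IsCut (G : SimpleGraph V) (e : Sym2 V) (χ : V → Bool) : Prop :=
  ∀ u v, G.Adj u v → (χ u ≠ χ v ↔ s(u, v) = e)

theorem preconnected_induction (hG : G.Preconnected) {S : V → Prop} {v : V} (hv : S v)
    (h : ∀ u w, G.Adj u w → S u → S w) (w : V) : S w := by
  obtain ⟨p⟩ := hG v w
  induction p with
  | nil => exact hv
  | cons hadj _ ih => exact ih (h _ _ hadj hv)

/-- Every edge of a tree is a bridge, so the vertices can be coloured by whether one endpoint still
reaches them after the edge is deleted. -/
theorem exists_isCut (hG : G.IsTree) {e : Sym2 V} (he : e ∈ G.edgeSet) : ∃ χ, IsCut G e χ := by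
  classical
  induction e with
  | h a b =>
    have hb := SimpleGraph.isBridge_iff.1 (SimpleGraph.isAcyclic_iff_forall_isBridge.1
      hG.isAcyclic he)
    refine ⟨fun v => decide ((G.deleteEdges {s(a, b)}).Reachable a v), fun u v huv => ?_⟩
    simp only [ne_eq, decide_eq_decide]
    constructor
    · intro h
      by_contra hne
      have hadj : (G.deleteEdges {s(a, b)}).Adj u v := by
        rw [SimpleGraph.deleteEdges_adj]
        exact ⟨huv, hne⟩
      exact h ⟨fun h1 => h1.trans hadj.reachable, fun h1 => h1.trans hadj.reachable.symm⟩
    · intro h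
      rcases Sym2.eq_iff.1 h with ⟨rfl, rfl⟩ | ⟨rfl, rfl⟩
      · exact fun h1 => hb (h1.1 SimpleGraph.Reachable.rfl)
      · exact fun h1 => hb (h1.2 SimpleGraph.Reachable.rfl)

theorem isTree_of_isCut (hG : G.Connected) (h : ∀ e ∈ G.edgeSet, ∃ χ, IsCut G e χ) :
    G.IsTree := by
  refine ⟨hG, SimpleGraph.isAcyclic_iff_forall_isBridge.2 fun e he => ?_⟩
  obtain ⟨χ, hχ⟩ := h e he
  induction e with
  | h a b =>
    rw [SimpleGraph.isBridge_iff]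
    rintro ⟨p⟩
    have key : ∀ {u v : V}, (G.deleteEdges {s(a, b)}).Walk u v → χ u = χ v := by
      intro u v p
      induction p with
      | nil => rfl
      | cons hadj _ ih =>
        rw [SimpleGraph.deleteEdges_adj] at hadj
        rw [← ih]
        by_contra hne
        exact hadj.2 ((hχ _ _ hadj.1).1 hne)
    exact (hχ a b he).2 rfl (key p)

/-- A two-colouring of the vertices that changes exactly along the edge `e` of a tree. -/
noncomputable def cut (G : SimpleGraph V) (e : Sym2 V) : V → Bool := Classical.epsilon (IsCut G e)

theorem isCut_cut (hG : G.IsTree) {e : Sym2 V} (he : e ∈ G.edgeSet) : IsCut G e (cut G e) :=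
  Classical.epsilon_spec (exists_isCut hG he)

/-- Both colourings change along the same edges, so whether they agree at a vertex is constant on
the connected graph. -/
theorem IsCut.eq_or_eq_not (hG : G.Connected) {e : Sym2 V} {χ χ' : V → Bool} (h : IsCut G e χ)
    (h' : IsCut G e χ') : χ = χ' ∨ χ = fun v => !χ' v := by
  obtain ⟨v₀⟩ := hG.nonempty
  have key : ∀ v, (χ v = χ' v ↔ χ v₀ = χ' v₀) := by
    refine preconnected_induction hG.preconnected (v := v₀) Iff.rfl fun u w huw ih => ?_
    rw [← ih]
    have h1 := h u w huw
    have h2 := h' u w huw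
    rw [← h2] at h1
    revert h1
    generalize χ u = a; generalize χ w = b; generalize χ' u = c; generalize χ' w = d
    revert a b c d; decide
  by_cases h0 : χ v₀ = χ' v₀
  · exact Or.inl (funext fun v => (key v).2 h0)
  · exact Or.inr (funext fun v => Bool.eq_not.2 (mt (key v).1 h0))

theorem cut_ne_iff (hG : G.IsTree) {e : Sym2 V} (he : e ∈ G.edgeSet) {u v : V}
    (huv : G.Adj u v) : cut G e u ≠ cut G e v ↔ s(u, v) = e :=
  isCut_cut hG he u v huv

theorem cut_ne (hG : G.IsTree) {u v : V} (huv : G.Adj u v) :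
    cut G s(u, v) u ≠ cut G s(u, v) v :=
  (cut_ne_iff hG huv huv).2 rfl

theorem cut_eq (hG : G.IsTree) {e : Sym2 V} (he : e ∈ G.edgeSet) {u v : V}
    (huv : G.Adj u v) (hne : s(u, v) ≠ e) : cut G e u = cut G e v := by
  by_contra h
  exact hne ((cut_ne_iff hG he huv).1 h)

/-- Of the four intersections of a side of `e` with a side of `e'`, one is empty. -/
theorem exists_corner_empty (hG : G.IsTree) {e e' : Sym2 V} (he : e ∈ G.edgeSet)
    (he' : e' ∈ G.edgeSet) (hne : e ≠ e') :
    ∃ β β' : Bool, ∀ z, ¬ (cut G e z = β ∧ cut G e' z = β') := by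
  induction e with
  | h a b =>
  induction e' with
  | h c d =>
    have h1 := cut_eq hG he' he hne
    have h2 := cut_eq hG he he' hne.symm
    -- The empty corner consists of the side of each edge that faces away from the other edge.
    refine ⟨!cut G s(a, b) c, !cut G s(c, d) a, ?_⟩
    refine preconnected_induction hG.connected.preconnected (v := a) (by simp) ?_
    intro u w huw hu hw
    by_cases h3 : s(u, w) = s(a, b)
    · rcases Sym2.eq_iff.1 h3 with ⟨rfl, rfl⟩ | ⟨rfl, rfl⟩
      · simp [h1] at hw
      · simp at hw
    · by_cases h4 : s(u, w) = s(c, d)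
      · rcases Sym2.eq_iff.1 h4 with ⟨rfl, rfl⟩ | ⟨rfl, rfl⟩
        · simp [h2] at hw
        · simp at hw
      · rw [← cut_eq hG he huw h3, ← cut_eq hG he' huw h4] at hw
        exact hu hw

theorem bool_eq_of_ne {a b c : Bool} (ha : a ≠ c) (hb : b ≠ c) : a = b := by
  revert a b c; decide

/-- No four vertices lie in the four intersections of the sides of two edges. -/
theorem corner_false (hG : G.IsTree) {e e' : Sym2 V} (he : e ∈ G.edgeSet)
    (he' : e' ∈ G.edgeSet) (hne : e ≠ e') {p q r t : V} (h1 : cut G e p = cut G e q)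
    (h2 : cut G e r = cut G e t) (h3 : cut G e p ≠ cut G e r) (h4 : cut G e' p = cut G e' r)
    (h5 : cut G e' q = cut G e' t) (h6 : cut G e' p ≠ cut G e' q) : False := by
  obtain ⟨β, β', h⟩ := exists_corner_empty hG he he' hne
  have hp := h p
  have hq := h q
  have hr := h r
  have ht := h t
  rw [← h1, ← h5] at *
  rw [← h2, h5] at ht
  rw [← h4] at hr
  rw [← h5] at ht
  clear h
  generalize cut G e p = a at *
  generalize cut G e r = b at *
  generalize cut G e' p = c at *
  generalize cut G e' q = d at *
  cases a <;> cases b <;> cases c <;> cases d <;> cases β <;> cases β' <;> simp_all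

/-- The first edge on the way from `v` to `w`. -/
theorem exists_adj_cut_ne (hG : G.IsTree) {v w : V} (hvw : w ≠ v) :
    ∃ c, G.Adj v c ∧ cut G s(v, c) w ≠ cut G s(v, c) v := by
  refine (preconnected_induction hG.connected.preconnected
    (S := fun w => w = v ∨ ∃ c, G.Adj v c ∧ cut G s(v, c) w ≠ cut G s(v, c) v)
    (Or.inl rfl) ?_ w).resolve_left hvw
  rintro u w huw (rfl | ⟨c, hc, hu⟩)
  · exact Or.inr ⟨w, huw, (cut_ne hG huw).symm⟩
  · by_cases h : s(u, w) = s(v, c)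
    · rcases Sym2.eq_iff.1 h with ⟨rfl, rfl⟩ | ⟨rfl, rfl⟩
      · exact absurd rfl hu
      · exact Or.inl rfl
    · exact Or.inr ⟨c, hc, by rwa [← cut_eq hG hc huw h]⟩

theorem eq_of_cut_eq (hG : G.IsTree) {u v : V} (h : ∀ e ∈ G.edgeSet, cut G e u = cut G e v) :
    u = v := by
  by_contra hne
  obtain ⟨c, hc, hcut⟩ := exists_adj_cut_ne hG hne
  exact hcut (h _ hc)

/-- Vertices separated by exactly one edge are the endpoints of that edge. -/
theorem adj_of_cut_ne (hG : G.IsTree) {u v : V} {e : Sym2 V}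
    (hne : cut G e u ≠ cut G e v) (h : ∀ f ∈ G.edgeSet, f ≠ e → cut G f u = cut G f v) :
    G.Adj u v ∧ s(u, v) = e := by
  have huv : v ≠ u := by rintro rfl; exact hne rfl
  obtain ⟨c, hc, hcut⟩ := exists_adj_cut_ne hG huv
  have h1 : s(u, c) = e := by
    by_contra h1
    exact hcut (h _ hc h1).symm
  have h2 : c = v := by
    refine eq_of_cut_eq hG fun f hf => ?_
    by_cases hfe : f = e
    · subst h1
      rw [hfe]
      exact bool_eq_of_ne (cut_ne hG hc).symm hne.symm
    · rw [← h f hf hfe]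
      exact (cut_eq hG hf hc fun h3 => hfe (h3.symm.trans h1)).symm
  subst h2
  exact ⟨hc, h1⟩

/-- The side of `e` that does not contain `m` lies beyond an edge at `m`. -/
theorem exists_adj_toward (hG : G.IsTree) {e : Sym2 V} (he : e ∈ G.edgeSet) {m b : V}
    (hb : cut G e b ≠ cut G e m) :
    ∃ c, G.Adj m c ∧ ∀ z, cut G e z ≠ cut G e m → cut G s(m, c) z ≠ cut G s(m, c) m := by
  have hbm : b ≠ m := by rintro rfl; exact hb rfl
  obtain ⟨c, hc, hcb⟩ := exists_adj_cut_ne hG hbm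
  refine ⟨c, hc, fun z hz hz' => ?_⟩
  by_cases hne : s(m, c) = e
  · subst hne; exact hz hz'
  · have h3 := cut_eq hG he hc hne
    exact corner_false hG he hc (Ne.symm hne) (p := m) (q := c) (r := z) (t := b) h3
      (bool_eq_of_ne hz hb) hz.symm hz'.symm
      (bool_eq_of_ne (cut_ne hG hc).symm hcb) (cut_ne hG hc)

/-- `m` is the median of three vertices: no edge separates it from two of them. -/
def IsMedian (G : SimpleGraph V) (u : Fin 3 → V) (m : V) : Prop :=
  ∀ e ∈ G.edgeSet, ∀ a b, a ≠ b → cut G e (u a) = cut G e m ∨ cut G e (u b) = cut G e m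

/-- Take `m` minimising the number of edges that separate it from two of the three vertices. If such
an edge remains, stepping towards those two vertices repairs the edge that is crossed and leaves the
status of all others unchanged. -/
theorem exists_isMedian [Finite V] (hG : G.IsTree) (u : Fin 3 → V) : ∃ m, IsMedian G u m := by
  classical
  cases nonempty_fintype V
  have := hG.connected.nonempty
  let bad : V → Sym2 V → Prop := fun m e => e ∈ G.edgeSet ∧ ∃ a b, a ≠ b ∧
    cut G e (u a) ≠ cut G e m ∧ cut G e (u b) ≠ cut G e m
  obtain ⟨m, hm⟩ := Finite.exists_min fun m => (Finset.univ.filter (bad m)).card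
  refine ⟨m, fun e he a b hab => ?_⟩
  by_contra! hcon
  obtain ⟨c, hc, hz⟩ := exists_adj_toward hG he hcon.1
  refine absurd (hm c) (not_le.2 (Finset.card_lt_card ?_))
  rw [Finset.ssubset_iff_of_subset]
  · refine ⟨s(m, c), ?_, ?_⟩
    · simp only [Finset.mem_filter, Finset.mem_univ, true_and]
      exact ⟨hc, a, b, hab, hz _ hcon.1, hz _ hcon.2⟩
    · simp only [Finset.mem_filter, Finset.mem_univ, true_and]
      rintro ⟨-, a', b', hab', h1, h2⟩
      have h3 := cut_ne hG hc
      have ha := bool_eq_of_ne (hz _ hcon.1) h3.symm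
      have hb := bool_eq_of_ne (hz _ hcon.2) h3.symm
      have h4 : a' ≠ a := by rintro rfl; exact h1 ha
      have h5 : a' ≠ b := by rintro rfl; exact h1 hb
      have h6 : b' ≠ a := by rintro rfl; exact h2 ha
      have h7 : b' ≠ b := by rintro rfl; exact h2 hb
      omega
  · intro f hf
    simp only [Finset.mem_filter, Finset.mem_univ, true_and] at hf ⊢
    obtain ⟨hf, a', b', hab', h1, h2⟩ := hf
    by_cases hfe : s(m, c) = f
    · subst hfe
      exact ⟨hf, a, b, hab, hz _ hcon.1, hz _ hcon.2⟩
    · rw [← cut_eq hG hf hc hfe] at h1 h2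
      exact ⟨hf, a', b', hab', h1, h2⟩

end Cuts

/-! ### Stability in terms of medians -/

section Stability

variable {V : Type} {G : SimpleGraph V} {n : ℕ} {leg : Fin n → V}

/-- Either `b` has no other edge, and stability forces a leg at `b`, or another edge at `b` bounds a
strictly smaller side within this one. The induction is on the size of the side. -/
theorem exists_leg_cut_eq [Finite V] (hG : G.IsTree)
    (hst : ∀ v, 3 ≤ (G.incidenceSet v).ncard + (leg ⁻¹' {v}).ncard) {a b : V}
    (hab : G.Adj a b) : ∃ i, cut G s(a, b) (leg i) = cut G s(a, b) b := by
  classical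
  cases nonempty_fintype V
  generalize hN : (Finset.univ.filter fun z => cut G s(a, b) z = cut G s(a, b) b).card = N
  induction N using Nat.strong_induction_on generalizing a b with
  | _ N ih =>
    by_cases hb : G.incidenceSet b ⊆ {s(a, b)}
    · have h1 := Set.ncard_le_ncard hb
      rw [Set.ncard_singleton] at h1
      have h2 : (leg ⁻¹' {b}).ncard ≠ 0 := by have := hst b; omega
      obtain ⟨i, hi⟩ := Set.nonempty_of_ncard_ne_zero h2
      exact ⟨i, by rw [show leg i = b from hi]⟩
    · rw [Set.not_subset] at hb
      obtain ⟨f, hf, hne⟩ := hb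
      have hfe : f ∈ G.edgeSet := hf.1
      obtain ⟨c, rfl⟩ : ∃ c, f = s(b, c) := ⟨_, (Sym2.other_spec hf.2).symm⟩
      have hbc : G.Adj b c := hfe
      have hsub : ∀ z, cut G s(b, c) z = cut G s(b, c) c → cut G s(a, b) z = cut G s(a, b) b := by
        intro z hz
        by_contra hcon
        have h1 : cut G s(a, b) b = cut G s(a, b) c := cut_eq hG hab hbc hne
        have h2 : cut G s(b, c) a = cut G s(b, c) b := cut_eq hG hbc hab (Ne.symm hne)
        exact corner_false hG hab hbc (Ne.symm hne) (p := b) (q := c) (r := a) (t := z) h1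
          (bool_eq_of_ne (cut_ne hG hab) hcon) (cut_ne hG hab).symm h2.symm hz.symm
          (cut_ne hG hbc)
      have hlt : (Finset.univ.filter fun z => cut G s(b, c) z = cut G s(b, c) c).card < N := by
        rw [← hN]
        refine Finset.card_lt_card ((Finset.ssubset_iff_of_subset ?_).2 ⟨b, ?_, ?_⟩)
        · intro z
          simpa using hsub z
        · simp
        · simpa using cut_ne hG hbc
      obtain ⟨i, hi⟩ := ih _ hlt hbc rfl
      exact ⟨i, hsub _ hi⟩

theorem ncard_add_ncard_eq [Finite V] (v : V) :
    (G.incidenceSet v).ncard + (leg ⁻¹' {v}).ncard =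
      Nat.card (G.incidenceSet v ⊕ ↥(leg ⁻¹' {v})) := by
  rw [Nat.card_sum, Nat.card_coe_set_eq, Nat.card_coe_set_eq]

/-- Call the edges and legs at `v` its directions. Following each direction to a leg gives one leg
per direction, and no edge separates two of these legs from `v`. Together with
`three_le_of_isMedian` this expresses stability by medians of legs, a form that passes easily to
contractions. -/
theorem exists_isMedian_leg [Finite V] (hG : G.IsTree)
    (hst : ∀ v, 3 ≤ (G.incidenceSet v).ncard + (leg ⁻¹' {v}).ncard) (v : V) :
    ∃ g : Fin 3 → Fin n, Function.Injective g ∧ IsMedian G (leg ∘ g) v := by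
  have key : ∀ d : G.incidenceSet v ⊕ ↥(leg ⁻¹' {v}), ∃ i : Fin n,
      Sum.elim (fun f => cut G f.1 (leg i) ≠ cut G f.1 v) (fun j => i = j.1) d := by
    rintro (f | j)
    · obtain ⟨c, hc⟩ : ∃ c, f.1 = s(v, c) := ⟨_, (Sym2.other_spec f.2.2).symm⟩
      have hvc : G.Adj v c := by
        rw [← SimpleGraph.mem_edgeSet, ← hc]
        exact f.2.1
      obtain ⟨i, hi⟩ := exists_leg_cut_eq hG hst hvc
      refine ⟨i, ?_⟩
      simp only [Sum.elim_inl, hc, hi]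
      exact (cut_ne hG hvc).symm
    · exact ⟨j.1, rfl⟩
  choose γ hγ using key
  have hmed : ∀ d d', d ≠ d' → ∀ e ∈ G.edgeSet,
      cut G e (leg (γ d)) = cut G e v ∨ cut G e (leg (γ d')) = cut G e v := by
    intro d d' hd e he
    by_contra! hcon
    obtain ⟨c, hc, hz⟩ := exists_adj_toward hG he hcon.1
    -- A chosen leg that `e` separates from `v` must have been chosen in the direction `c` leading
    -- to `e`.
    have h1 : ∀ d : G.incidenceSet v ⊕ ↥(leg ⁻¹' {v}),
        cut G e (leg (γ d)) ≠ cut G e v → ∃ h : s(v, c) ∈ G.incidenceSet v,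
          d = Sum.inl ⟨s(v, c), h⟩ := by
      rintro (f | j) hd
      · refine ⟨⟨hc, Sym2.mem_mk_left _ _⟩, ?_⟩
        by_contra hne
        have hfne : f.1 ≠ s(v, c) := fun h => hne (congrArg Sum.inl (Subtype.ext h))
        obtain ⟨x, hx⟩ : ∃ x, f.1 = s(v, x) := ⟨_, (Sym2.other_spec f.2.2).symm⟩
        have hvx : G.Adj v x := by
          rw [← SimpleGraph.mem_edgeSet, ← hx]
          exact f.2.1
        have hγf := hγ (Sum.inl f)
        simp only [Sum.elim_inl, hx] at hγf
        rw [hx] at hfne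
        exact corner_false hG hvx hc hfne (p := v) (q := c) (r := x) (t := leg (γ (Sum.inl f)))
          (cut_eq hG hvx hc hfne.symm) (bool_eq_of_ne (cut_ne hG hvx).symm hγf)
          (cut_ne hG hvx) (cut_eq hG hc hvx hfne)
          (bool_eq_of_ne (cut_ne hG hc).symm (hz _ hd)) (cut_ne hG hc)
      · have hj := hγ (Sum.inr j)
        simp only [Sum.elim_inr] at hj
        rw [hj, show leg j.1 = v from j.2] at hd
        exact absurd rfl hd
    obtain ⟨_, h2⟩ := h1 d hcon.1
    obtain ⟨_, h3⟩ := h1 d' hcon.2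
    exact hd (h2.trans h3.symm)
  have hinj : Function.Injective γ := by
    intro d d' h
    by_contra hne
    have h1 : leg (γ d) = v := eq_of_cut_eq hG fun e he => by
      rcases hmed d d' hne e he with h2 | h2
      · exact h2
      · rwa [← h] at h2
    have h3 : ∀ d, leg (γ d) = v → ∃ j, d = Sum.inr j ∧ γ d = j.1 := by
      rintro (f | j) hd
      · exact absurd (by rw [hd]) (hγ (Sum.inl f))
      · exact ⟨j, rfl, hγ (Sum.inr j)⟩
    obtain ⟨j, hj, hj'⟩ := h3 d h1
    obtain ⟨j', hk, hk'⟩ := h3 d' (h ▸ h1)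
    refine hne (hj.trans (Eq.trans ?_ hk.symm))
    rw [Subtype.ext (hj'.symm.trans (h.trans hk'))]
  have h3 := hst v
  rw [ncard_add_ncard_eq] at h3
  have : Fintype (G.incidenceSet v ⊕ ↥(leg ⁻¹' {v})) := Fintype.ofFinite _
  obtain ⟨ι⟩ : Nonempty (Fin 3 ↪ G.incidenceSet v ⊕ ↥(leg ⁻¹' {v})) :=
    Function.Embedding.nonempty_of_card_le (by simpa [Nat.card_eq_fintype_card] using h3)
  exact ⟨γ ∘ ι, hinj.comp ι.injective, fun e he a b hab => hmed _ _ (ι.injective.ne hab) e he⟩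

/-- Each of the three legs leaves `v` in some direction, and two legs sharing a direction would
violate the median condition. -/
theorem three_le_of_isMedian [Finite V] (hG : G.IsTree) {v : V} {g : Fin 3 → Fin n}
    (hg : Function.Injective g) (hm : IsMedian G (leg ∘ g) v) :
    3 ≤ (G.incidenceSet v).ncard + (leg ⁻¹' {v}).ncard := by
  have key : ∀ a : Fin 3, ∃ d : G.incidenceSet v ⊕ ↥(leg ⁻¹' {v}),
      Sum.elim (fun f => cut G f.1 (leg (g a)) ≠ cut G f.1 v) (fun j => g a = j.1) d := by
    intro a
    by_cases h : leg (g a) = v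
    · exact ⟨Sum.inr ⟨g a, h⟩, rfl⟩
    · obtain ⟨c, hc, hcut⟩ := exists_adj_cut_ne hG h
      exact ⟨Sum.inl ⟨s(v, c), hc, Sym2.mem_mk_left _ _⟩, hcut⟩
  choose δ hδ using key
  have hinj : Function.Injective δ := by
    intro a b h
    by_contra hab
    have ha := hδ a
    have hb := hδ b
    rw [← h] at hb
    rcases hd : δ a with f | j
    · simp only [hd, Sum.elim_inl] at ha hb
      rcases hm f.1 f.2.1 a b hab with h1 | h1
      · exact ha h1
      · exact hb h1
    · simp only [hd, Sum.elim_inr] at ha hb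
      exact hab (hg (ha.trans hb.symm))
  rw [ncard_add_ncard_eq]
  simpa using Nat.card_le_card_of_injective δ hinj

end Stability

/-! ### Splits -/

section Splits

variable {n : ℕ}

/-- The partition of the legs induced by an edge. -/
noncomputable def StableTree.split (Γ : StableTree n) (e : Γ.Edge) : Setoid (Fin n) :=
  Setoid.ker fun i => cut Γ.graph e.1 (Γ.leg i)

theorem StableTree.split_rel (Γ : StableTree n) (e : Γ.Edge) (i j : Fin n) :
    Γ.split e i j ↔ cut Γ.graph e.1 (Γ.leg i) = cut Γ.graph e.1 (Γ.leg j) := Iff.rfl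

theorem StableTree.exists_median (Γ : StableTree n) (v : Fin Γ.k) :
    ∃ g : Fin 3 → Fin n, Function.Injective g ∧ IsMedian Γ.graph (Γ.leg ∘ g) v :=
  exists_isMedian_leg Γ.isTree Γ.stable v

/-- Two properties that each fail at most once among three indices hold together somewhere. -/
theorem exists_common_of_pairs {P Q : Fin 3 → Prop} (hP : ∀ a b, a ≠ b → P a ∨ P b)
    (hQ : ∀ a b, a ≠ b → Q a ∨ Q b) : ∃ a, P a ∧ Q a := by
  have h1 := hP 0 1 (by decide)
  have h2 := hP 0 2 (by decide)
  have h3 := hP 1 2 (by decide)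
  have h4 := hQ 0 1 (by decide)
  have h5 := hQ 0 2 (by decide)
  have h6 := hQ 1 2 (by decide)
  by_contra! h
  have := h 0
  have := h 1
  have := h 2
  tauto

/-- Any two edges have a leg on the same sides of both edges as a given vertex. -/
theorem StableTree.exists_leg (Γ : StableTree n) (v : Fin Γ.k) (e f : Γ.Edge) :
    ∃ i, cut Γ.graph e.1 (Γ.leg i) = cut Γ.graph e.1 v ∧
      cut Γ.graph f.1 (Γ.leg i) = cut Γ.graph f.1 v := by
  obtain ⟨g, -, hm⟩ := Γ.exists_median v
  obtain ⟨a, ha⟩ := exists_common_of_pairs (hm e.1 e.2) (hm f.1 f.2)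
  exact ⟨g a, ha⟩

/-- By stability every corner of two edges that contains a vertex contains a leg. As one corner is
empty, the two corners on one side of `e` are both inhabited; their legs are separated by `f` but
not by `e`. -/
theorem StableTree.split_injective (Γ : StableTree n) : Function.Injective Γ.split := by
  intro e f h
  by_contra hne
  have hef : e.1 ≠ f.1 := fun h => hne (Subtype.ext h)
  obtain ⟨β, β', hc⟩ := exists_corner_empty Γ.isTree e.2 f.2 hef
  obtain ⟨v, hv⟩ : ∃ v, cut Γ.graph e.1 v = β ∧ cut Γ.graph f.1 v ≠ β' := by
    obtain ⟨⟨a, b⟩, hab⟩ := e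
    have := cut_ne Γ.isTree hab
    by_cases ha : cut Γ.graph s(a, b) a = β
    · exact ⟨a, ha, fun h => hc a ⟨ha, h⟩⟩
    · have hb : cut Γ.graph s(a, b) b = β := bool_eq_of_ne this.symm (Ne.symm ha)
      exact ⟨b, hb, fun h => hc b ⟨hb, h⟩⟩
  obtain ⟨w, hw⟩ : ∃ w, cut Γ.graph e.1 w ≠ β ∧ cut Γ.graph f.1 w = β' := by
    obtain ⟨⟨a, b⟩, hab⟩ := f
    have := cut_ne Γ.isTree hab
    by_cases ha : cut Γ.graph s(a, b) a = β'
    · exact ⟨a, fun h => hc a ⟨h, ha⟩, ha⟩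
    · have hb : cut Γ.graph s(a, b) b = β' := bool_eq_of_ne this.symm (Ne.symm ha)
      exact ⟨b, fun h => hc b ⟨h, hb⟩, hb⟩
  obtain ⟨u, hu⟩ : ∃ u, cut Γ.graph e.1 u ≠ β ∧ cut Γ.graph f.1 u ≠ β' := by
    obtain ⟨⟨a, b⟩, hab⟩ := e
    have h1 := cut_ne Γ.isTree hab
    have h2 := cut_eq Γ.isTree f.2 hab hef
    by_cases ha : cut Γ.graph s(a, b) a = β
    · exact ⟨b, fun h => h1 (ha.trans h.symm), fun h => hc a ⟨ha, h2.trans h⟩⟩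
    · have hb : cut Γ.graph s(a, b) b = β := bool_eq_of_ne h1.symm (Ne.symm ha)
      exact ⟨a, ha, fun h => hc b ⟨hb, h2.symm.trans h⟩⟩
  obtain ⟨i, hi⟩ := Γ.exists_leg v e f
  obtain ⟨j, hj⟩ := Γ.exists_leg u e f
  obtain ⟨l, hl⟩ := Γ.exists_leg w e f
  have h1 := Γ.split_rel e j l
  rw [h, Γ.split_rel, hj.1, hj.2, hl.1, hl.2] at h1
  exact hu.2 ((h1.2 (bool_eq_of_ne hu.1 hw.1)).trans hw.2)

/-- `cut` is an arbitrary choice between two opposite colourings; the partition of the legs does not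
depend on it. -/
theorem StableTree.ker_eq_split (Γ : StableTree n) {e : Γ.Edge} {χ : Fin Γ.k → Bool}
    (h : IsCut Γ.graph e.1 χ) : Setoid.ker (fun i => χ (Γ.leg i)) = Γ.split e := by
  rcases h.eq_or_eq_not Γ.isTree.connected (isCut_cut Γ.isTree e.2) with h | h
  · rw [h]; rfl
  · ext i j
    rw [Setoid.ker_def, Γ.split_rel, h, Bool.not_inj_iff]

/-! ### Weights of splits -/

variable {R : Type}

open Classical in
/-- The weights of the splits given by a length function. -/
noncomputable def StableTree.weight [AddCommMonoid R] (Γ : StableTree n) (x : Γ.Edge → R)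
    (s : Setoid (Fin n)) : R :=
  ∑ e, if Γ.split e = s then x e else 0

theorem StableTree.weight_split [AddCommMonoid R] (Γ : StableTree n) (x : Γ.Edge → R)
    (e : Γ.Edge) : Γ.weight x (Γ.split e) = x e := by
  classical
  rw [StableTree.weight, Finset.sum_eq_single e]
  · simp
  · intro f _ hf
    rw [if_neg fun h => hf (Γ.split_injective h)]
  · simp

theorem StableTree.weight_eq_zero [AddCommMonoid R] (Γ : StableTree n) (x : Γ.Edge → R)
    {s : Setoid (Fin n)} (hs : s ∉ Set.range Γ.split) : Γ.weight x s = 0 := by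
  classical
  exact Finset.sum_eq_zero fun e _ => if_neg fun h => hs ⟨e, h⟩

/-- The edge `e` lies in no fibre, because its image is not a loop. Since fibres are connected, the
sides of `e` are unions of fibres, and `e` is the only edge above `e'`. -/
theorem Contraction.isCut_comp {Γ Γ' : StableTree n} (c : Contraction Γ Γ') {e : Γ.Edge}
    {e' : Γ'.Edge} (h : Sym2.map c.toFun e.1 = e'.1) {χ : Fin Γ'.k → Bool}
    (hχ : IsCut Γ'.graph e'.1 χ) : IsCut Γ.graph e.1 (χ ∘ c.toFun) := by
  have hfib : ∀ v w, c.toFun v = c.toFun w → cut Γ.graph e.1 v = cut Γ.graph e.1 w := by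
    intro v w hvw
    have h1 := (c.connected_fiber (c.toFun w)).preconnected
    refine preconnected_induction h1 (v := ⟨w, rfl⟩)
      (S := fun z => cut Γ.graph e.1 z.1 = cut Γ.graph e.1 w) rfl ?_ ⟨v, hvw⟩
    rintro ⟨a, ha⟩ ⟨b, hb⟩ hab hS
    have hab' : Γ.graph.Adj a b := hab
    rw [← cut_eq Γ.isTree e.2 hab', hS]
    intro hcon
    rw [← hcon, Sym2.map_mk] at h
    have h3 : Γ'.graph.Adj (c.toFun a) (c.toFun b) := by
      rw [← SimpleGraph.mem_edgeSet, h]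
      exact e'.2
    exact h3.ne (Eq.trans ha (Eq.symm hb))
  intro a b hab
  simp only [Function.comp_apply]
  constructor
  · intro hne
    have hne' : c.toFun a ≠ c.toFun b := fun h => hne (by rw [h])
    have h1 := (hχ _ _ ((c.adj_iff _ _).2 ⟨hne', a, b, rfl, rfl, hab⟩)).1 hne
    obtain ⟨⟨v, w⟩, he⟩ := e
    have h3 : s(c.toFun v, c.toFun w) = s(c.toFun a, c.toFun b) := h.trans h1.symm
    rw [← cut_ne_iff Γ.isTree he hab]
    have h4 := cut_ne Γ.isTree he
    rcases Sym2.eq_iff.1 h3 with ⟨h5, h6⟩ | ⟨h5, h6⟩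
    · rw [← hfib _ _ h5, ← hfib _ _ h6]
      exact h4
    · rw [← hfib _ _ h5, ← hfib _ _ h6]
      exact h4.symm
  · intro he
    have h1 : s(c.toFun a, c.toFun b) = e'.1 := by
      rw [← h, ← he, Sym2.map_mk]
    refine (hχ _ _ ?_).2 h1
    rw [← SimpleGraph.mem_edgeSet, h1]
    exact e'.2

theorem Contraction.split_eq {Γ Γ' : StableTree n} (c : Contraction Γ Γ') {e : Γ.Edge}
    {e' : Γ'.Edge} (h : Sym2.map c.toFun e.1 = e'.1) : Γ.split e = Γ'.split e' := by
  rw [← Γ.ker_eq_split (c.isCut_comp h (isCut_cut Γ'.isTree e'.2))]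
  simp only [Function.comp_apply, c.map_leg]
  rfl

theorem Contraction.exists_map_eq {Γ Γ' : StableTree n} (c : Contraction Γ Γ') (e' : Γ'.Edge) :
    ∃ e : Γ.Edge, Sym2.map c.toFun e.1 = e'.1 := by
  obtain ⟨⟨x, y⟩, h⟩ := e'
  obtain ⟨-, v, w, rfl, rfl, hvw⟩ := (c.adj_iff x y).1 h
  exact ⟨⟨s(v, w), hvw⟩, rfl⟩

/-- Surviving edges keep their splits and lengths. A contracted edge has length zero, and its split
does not occur in `Γ'` by injectivity of `split`. Hence weights descend to the glued space. -/
theorem Contraction.weight_extend [AddCommMonoid R] {Γ Γ' : StableTree n} (c : Contraction Γ Γ')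
    (x : Γ'.Edge → R) : Γ.weight (c.extend x) = Γ'.weight x := by
  funext s
  by_cases hs : s ∈ Set.range Γ.split
  · obtain ⟨e, rfl⟩ := hs
    rw [Γ.weight_split, Contraction.extend]
    split_ifs with h
    · rw [c.split_eq (e := e) (e' := ⟨_, h⟩) rfl]
      exact (Γ'.weight_split x _).symm
    · rw [Γ'.weight_eq_zero]
      rintro ⟨e', he'⟩
      obtain ⟨f, hf⟩ := c.exists_map_eq e'
      rw [← c.split_eq hf] at he'
      rw [Γ.split_injective he'] at hf
      exact h (hf ▸ e'.2)
  · rw [Γ.weight_eq_zero _ hs, Γ'.weight_eq_zero]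
    rintro ⟨e', rfl⟩
    obtain ⟨f, hf⟩ := c.exists_map_eq e'
    exact hs ⟨f, c.split_eq hf⟩

/-- The weights of the splits at a point of the moduli space. -/
noncomputable def Moduli.weight [AddCommMonoid R] : Moduli R n → Setoid (Fin n) → R :=
  Quot.lift (fun p => p.1.weight p.2) (by
    rintro ⟨Γ', x⟩ ⟨Γ, y⟩ ⟨c, hc⟩
    simp only at hc
    simp only [hc, c.weight_extend])

theorem Moduli.weight_mk [AddCommMonoid R] (Γ : StableTree n) (x : Γ.Edge → R) :
    (Moduli.mk Γ x).weight = Γ.weight x := rfl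

end Splits

/-! ### Trees are determined by their splits -/

section Reconstruction

variable {n : ℕ}

/-- The vertex set of a `StableTree` has the form `Fin k`, so quotients have to be relabelled. -/
theorem exists_surjective_fin {α β : Type} [Finite α] (F : α → β) :
    ∃ (k : ℕ) (F' : α → Fin k), Function.Surjective F' ∧ ∀ v w, F' v = F' w ↔ F v = F w := by
  obtain ⟨k, ⟨ε⟩⟩ := Finite.exists_equiv_fin (Set.range F)
  refine ⟨k, fun v => ε ⟨F v, v, rfl⟩, fun y => ?_, fun v w => ?_⟩
  · obtain ⟨v, hv⟩ := (ε.symm y).2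
    refine ⟨v, ?_⟩
    rw [← ε.apply_symm_apply y]
    exact congrArg ε (Subtype.ext hv)
  · exact ε.apply_eq_iff_eq.trans Subtype.ext_iff

/-- This contracts the edges outside `P`: vertices are identified when no edge of `P` separates
them. The cuts of the edges in `P` descend, which makes the quotient a tree, and medians of legs
descend, which makes it stable. -/
theorem StableTree.exists_range_split_eq (Γ : StableTree n) (P : Set Γ.Edge) :
    ∃ Γ' : StableTree n, Set.range Γ'.split = Γ.split '' P := by
  classical
  obtain ⟨k, F, hsurj, hF⟩ :=
    exists_surjective_fin fun (v : Fin Γ.k) (e : P) => cut Γ.graph e.1.1 v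
  have hF' : ∀ v w, F v = F w ↔ ∀ e : Γ.Edge, e ∈ P → cut Γ.graph e.1 v = cut Γ.graph e.1 w := by
    intro v w
    rw [hF, funext_iff]
    exact ⟨fun h e he => h ⟨e, he⟩, fun h e => h e.1 e.2⟩
  let G : SimpleGraph (Fin k) :=
    { Adj := fun x y => x ≠ y ∧ ∃ v w, F v = x ∧ F w = y ∧ Γ.graph.Adj v w
      symm := ⟨by
        rintro x y ⟨hne, v, w, hv, hw, h⟩
        exact ⟨hne.symm, w, v, hw, hv, h.symm⟩⟩
      loopless := ⟨fun x h => h.1 rfl⟩ }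
  have hconn : G.Connected := by
    have : Nonempty (Fin k) := Γ.isTree.connected.nonempty.map F
    refine ⟨fun x y => ?_⟩
    obtain ⟨v, rfl⟩ := hsurj x
    obtain ⟨w, rfl⟩ := hsurj y
    refine preconnected_induction Γ.isTree.connected.preconnected (v := v)
      (S := fun w => G.Reachable (F v) (F w)) (SimpleGraph.Reachable.refl _) ?_ w
    intro a b hab ha
    by_cases h : F a = F b
    · rwa [← h]
    · exact ha.trans (SimpleGraph.Adj.reachable ⟨h, a, b, rfl, rfl, hab⟩)
  let χ : Γ.Edge → Fin k → Bool := fun e x => cut Γ.graph e.1 (Function.surjInv hsurj x)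
  have hχ : ∀ e ∈ P, ∀ v, χ e (F v) = cut Γ.graph e.1 v := by
    intro e he v
    exact (hF' _ _).1 (Function.surjInv_eq hsurj (F v)) e he
  have hcut : ∀ e ∈ P, IsCut G (Sym2.map F e.1) (χ e) := by
    rintro e he x y ⟨hne, v, w, rfl, rfl, hvw⟩
    rw [hχ e he, hχ e he]
    constructor
    · intro h
      rw [← (cut_ne_iff Γ.isTree e.2 hvw).1 h, Sym2.map_mk]
    · obtain ⟨⟨a, b⟩, hab⟩ := e
      intro h
      have h3 : s(F v, F w) = s(F a, F b) := h
      have h4 := cut_ne Γ.isTree hab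
      rcases Sym2.eq_iff.1 h3 with ⟨h5, h6⟩ | ⟨h5, h6⟩
      · rwa [(hF' _ _).1 h5 _ he, (hF' _ _).1 h6 _ he]
      · rw [(hF' _ _).1 h5 _ he, (hF' _ _).1 h6 _ he]
        exact h4.symm
  have hedge : ∀ e' ∈ G.edgeSet, ∃ e ∈ P, e' = Sym2.map F e.1 := by
    rintro ⟨x, y⟩ ⟨hne, v, w, rfl, rfl, hvw⟩
    rw [ne_eq, hF'] at hne
    push Not at hne
    obtain ⟨e, he, hne⟩ := hne
    exact ⟨e, he, by rw [← (cut_ne_iff Γ.isTree e.2 hvw).1 hne]; rfl⟩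
  have hmem : ∀ e ∈ P, Sym2.map F e.1 ∈ G.edgeSet := by
    rintro ⟨⟨a, b⟩, hab⟩ he
    refine ⟨fun h => ?_, a, b, rfl, rfl, hab⟩
    exact cut_ne Γ.isTree hab ((hF' _ _).1 h _ he)
  have htree : G.IsTree := isTree_of_isCut hconn fun e' he' => by
    obtain ⟨e, he, rfl⟩ := hedge e' he'
    exact ⟨_, hcut e he⟩
  let Γ' : StableTree n :=
    { k := k
      graph := G
      isTree := htree
      leg := fun i => F (Γ.leg i)
      stable := by
        intro x
        obtain ⟨v, rfl⟩ := hsurj x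
        obtain ⟨g, hg, hm⟩ := Γ.exists_median v
        refine three_le_of_isMedian htree hg fun e' he' a b hab => ?_
        obtain ⟨e, he, rfl⟩ := hedge e' he'
        have key : ∀ u, cut Γ.graph e.1 u = cut Γ.graph e.1 v →
            cut G (Sym2.map F e.1) (F u) = cut G (Sym2.map F e.1) (F v) := by
          intro u hu
          rw [← hχ e he, ← hχ e he] at hu
          rcases (hcut e he).eq_or_eq_not hconn (isCut_cut htree he') with h | h
          · rwa [h] at hu
          · rwa [h, Bool.not_inj_iff] at hu
        exact (hm e.1 e.2 a b hab).imp (key _) (key _) }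
  have hsplit : ∀ e (he : e ∈ P), Γ'.split ⟨_, hmem e he⟩ = Γ.split e := by
    intro e he
    rw [← Γ'.ker_eq_split (e := ⟨_, hmem e he⟩) (hcut e he)]
    ext i j
    exact (Iff.of_eq (congrArg₂ (· = ·) (hχ e he (Γ.leg i)) (hχ e he (Γ.leg j))))
  refine ⟨Γ', Set.ext fun s => ⟨?_, ?_⟩⟩
  · rintro ⟨⟨e', he'⟩, rfl⟩
    obtain ⟨e, he, rfl⟩ := hedge e' he'
    exact ⟨e, he, (hsplit e he).symm⟩
  · rintro ⟨e, he, rfl⟩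
    exact ⟨_, hsplit e he⟩

theorem eq_or_eq_not_of_ker_eq {α : Type} {f g : α → Bool} (h : Setoid.ker f = Setoid.ker g) :
    f = g ∨ f = fun i => !g i := by
  have h' : ∀ i j, f i = f j ↔ g i = g j := fun i j => Setoid.ext_iff.1 h i j
  by_cases hi : ∃ i, f i = g i
  · obtain ⟨i, hi⟩ := hi
    refine Or.inl (funext fun j => ?_)
    have := h' i j
    revert this hi
    generalize f i = a; generalize f j = b; generalize g i = c; generalize g j = d
    revert a b c d; decide
  · push Not at hi
    exact Or.inr (funext fun i => Bool.eq_not.2 (hi i))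

theorem IsCut.eq_iff_cut_eq {V : Type} {G : SimpleGraph V} (hG : G.IsTree) {e : Sym2 V}
    (he : e ∈ G.edgeSet) {χ : V → Bool} (h : IsCut G e χ) (u v : V) :
    χ u = χ v ↔ cut G e u = cut G e v := by
  rcases h.eq_or_eq_not hG.connected (isCut_cut hG he) with h | h
  · rw [h]
  · rw [h, Bool.not_inj_iff]

theorem IsCut.not {V : Type} {G : SimpleGraph V} {e : Sym2 V} {χ : V → Bool} (h : IsCut G e χ) :
    IsCut G e fun v => !χ v := by
  intro u v huv
  rw [ne_eq, Bool.not_inj_iff]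
  exact h u v huv

/-- A vertex `v` of `Γ` should go to the vertex of `Γ'` on the corresponding side of every edge of
`Γ'`. It exists because `v` is the median of three legs: the side of a median is decided by majority
among the legs, so the median of the same legs in `Γ'` has the required sides. -/
theorem StableTree.nonempty_contraction {Γ Γ' : StableTree n}
    (h : Set.range Γ'.split ⊆ Set.range Γ.split) : Nonempty (Contraction Γ Γ') := by
  classical
  -- The colouring `ψ` is oriented so that it agrees with the cut of `e'` on legs, not merely up to
  -- exchanging the colours.
  have h1 : ∀ e' : Γ'.Edge, ∃ (e : Γ.Edge) (ψ : Fin Γ.k → Bool), Γ.split e = Γ'.split e' ∧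
      IsCut Γ.graph e.1 ψ ∧ ∀ i, ψ (Γ.leg i) = cut Γ'.graph e'.1 (Γ'.leg i) := by
    intro e'
    obtain ⟨e, he⟩ := h ⟨e', rfl⟩
    rcases eq_or_eq_not_of_ker_eq he with h | h
    · exact ⟨e, _, he, isCut_cut Γ.isTree e.2, congrFun h⟩
    · exact ⟨e, _, he, (isCut_cut Γ.isTree e.2).not, fun i => by
        rw [congrFun h i, Bool.not_not]⟩
  choose ι ψ hι hψ hleg using h1
  have hψeq : ∀ e' u v, ψ e' u = ψ e' v ↔ cut Γ.graph (ι e').1 u = cut Γ.graph (ι e').1 v :=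
    fun e' u v => (hψ e').eq_iff_cut_eq Γ.isTree (ι e').2 u v
  have hinj : Function.Injective ι := fun e f hef => Γ'.split_injective <| by
    rw [← hι, ← hι, hef]
  have hmed : ∀ (g : Fin 3 → Fin n) v v', IsMedian Γ.graph (Γ.leg ∘ g) v →
      IsMedian Γ'.graph (Γ'.leg ∘ g) v' → ∀ e' : Γ'.Edge, cut Γ'.graph e'.1 v' = ψ e' v := by
    intro g v v' hv hv' e'
    obtain ⟨a, ha, ha'⟩ := exists_common_of_pairs (hv _ (ι e').2) (hv' _ e'.2)
    rw [← ha', ← (hψeq _ _ _).2 ha]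
    exact (hleg _ _).symm
  have hF : ∀ v, ∃ v', ∀ e' : Γ'.Edge, cut Γ'.graph e'.1 v' = ψ e' v := by
    intro v
    obtain ⟨g, -, hg⟩ := Γ.exists_median v
    obtain ⟨v', hv'⟩ := exists_isMedian Γ'.isTree (Γ'.leg ∘ g)
    exact ⟨v', hmed g v v' hg hv'⟩
  have hsurj : ∀ v', ∃ v, ∀ e' : Γ'.Edge, cut Γ'.graph e'.1 v' = ψ e' v := by
    intro v'
    obtain ⟨g, -, hg⟩ := Γ'.exists_median v'
    obtain ⟨v, hv⟩ := exists_isMedian Γ.isTree (Γ.leg ∘ g)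
    exact ⟨v, hmed g v v' hv hg⟩
  choose F hF using hF
  have hext : ∀ v' v, (∀ e' : Γ'.Edge, cut Γ'.graph e'.1 v' = ψ e' v) → F v = v' := by
    intro v' v hv
    exact eq_of_cut_eq Γ'.isTree fun e he => by rw [hF v ⟨e, he⟩, hv ⟨e, he⟩]
  have hψF : ∀ v w, F v = F w → ∀ e', ψ e' v = ψ e' w := by
    intro v w hvw e'
    rw [← hF, ← hF, hvw]
  refine ⟨⟨F, fun i => hext _ _ fun e' => (hleg e' i).symm, fun w => ?_, fun x y => ?_⟩⟩
  -- To connect `x` and `y` within a fibre, step from `x` towards `y`. The edge crossed separates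
  -- `x` from `y`, hence is no `ι e'`, so the step stays in the fibre and lowers the number of
  -- separating edges.
  · have hreach : ∀ (N : ℕ) (x y : F ⁻¹' {w}),
        (Finset.univ.filter fun e : Γ.Edge =>
          cut Γ.graph e.1 x ≠ cut Γ.graph e.1 y).card = N →
        (Γ.graph.induce (F ⁻¹' {w})).Reachable x y := by
      intro N
      induction N using Nat.strong_induction_on with
      | _ N ih =>
        rintro ⟨x, hx⟩ ⟨y, hy⟩ hN
        by_cases hxy : y = x
        · subst hxy
          exact SimpleGraph.Reachable.refl _
        obtain ⟨c, hc, hcy⟩ := exists_adj_cut_ne Γ.isTree hxy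
        have hcF : F c = w := by
          refine hext _ _ fun e' => ?_
          rw [← show F x = w from hx, hF, hψeq]
          refine cut_eq Γ.isTree (ι e').2 hc fun he => hcy ?_
          rw [he, ← hψeq]
          exact hψF _ _ ((show F y = w from hy).trans (show F x = w from hx).symm) e'
        have hadj : (Γ.graph.induce (F ⁻¹' {w})).Adj ⟨x, hx⟩ ⟨c, hcF⟩ := hc
        refine hadj.reachable.trans (ih _ ?_ ⟨c, hcF⟩ ⟨y, hy⟩ rfl)
        rw [← hN]
        refine Finset.card_lt_card ((Finset.ssubset_iff_of_subset ?_).2 ⟨⟨s(x, c), hc⟩, ?_, ?_⟩)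
        · intro e he
          simp only [Finset.mem_filter, Finset.mem_univ, true_and] at he ⊢
          by_cases hxe : s(x, c) = e.1
          · rw [← hxe]
            exact hcy.symm
          · rwa [cut_eq Γ.isTree e.2 hc hxe]
        · exact Finset.mem_filter.2 ⟨Finset.mem_univ _, hcy.symm⟩
        · exact fun h => (Finset.mem_filter.1 h).2
            (bool_eq_of_ne (cut_ne Γ.isTree hc).symm hcy)
    obtain ⟨v, hv⟩ := hsurj w
    have : Nonempty (F ⁻¹' {w}) := ⟨⟨v, hext _ _ hv⟩⟩
    exact ⟨fun x y => hreach _ x y rfl⟩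
  · have hdiff : ∀ (e' : Γ'.Edge) v w, s(v, w) = (ι e').1 → Γ'.graph.Adj (F v) (F w) ∧
        s(F v, F w) = e'.1 := by
      intro e' v w hvw
      have hadj : Γ.graph.Adj v w := by
        rw [← SimpleGraph.mem_edgeSet, hvw]
        exact (ι e').2
      refine adj_of_cut_ne Γ'.isTree ?_ fun f hf hne => ?_
      · rw [hF, hF]
        exact (hψ e' v w hadj).2 hvw
      · refine (hF v ⟨f, hf⟩).trans (Eq.trans ((hψeq ⟨f, hf⟩ v w).2 ?_) (hF w ⟨f, hf⟩).symm)
        refine cut_eq Γ.isTree (ι _).2 hadj fun h => hne ?_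
        have := hinj (Subtype.ext (hvw.symm.trans h))
        exact (congrArg Subtype.val this).symm
    constructor
    · intro hxy
      refine ⟨hxy.ne, ?_⟩
      generalize hι' : ι ⟨s(x, y), hxy⟩ = e
      obtain ⟨⟨a, b⟩, hab⟩ := e
      have h3 := (hdiff ⟨s(x, y), hxy⟩ a b (by rw [hι'])).2
      rcases Sym2.eq_iff.1 h3 with ⟨h5, h6⟩ | ⟨h5, h6⟩
      · exact ⟨a, b, h5, h6, hab⟩
      · exact ⟨b, a, h6, h5, SimpleGraph.Adj.symm hab⟩
    · rintro ⟨hne, v, w, rfl, rfl, hvw⟩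
      obtain ⟨e', he'⟩ : ∃ e', ψ e' v ≠ ψ e' w := by
        by_contra! hcon
        exact hne (hext _ _ fun e' => by rw [hF, hcon])
      exact (hdiff e' v w ((hψ e' v w hvw).1 he')).1

variable {R : Type}

theorem StableTree.weight_injective [AddCommMonoid R] (Γ : StableTree n) :
    Function.Injective (Γ.weight : (Γ.Edge → R) → Setoid (Fin n) → R) := fun x y h =>
  funext fun e => by rw [← Γ.weight_split x, ← Γ.weight_split y, h]

theorem StableTree.mk_eq_mk_of_range_subset [AddCommMonoid R] {Γ Γ' : StableTree n}
    (h : Set.range Γ'.split ⊆ Set.range Γ.split) {x : Γ.Edge → R} {x' : Γ'.Edge → R}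
    (hw : Γ.weight x = Γ'.weight x') : Moduli.mk Γ x = Moduli.mk Γ' x' := by
  obtain ⟨c⟩ := StableTree.nonempty_contraction h
  exact (Quot.sound ⟨c, Γ.weight_injective (by simp only [hw, c.weight_extend])⟩).symm

/-- A point of the moduli space is determined by the weights of the splits. -/
theorem Moduli.weight_injective [AddCommMonoid R] :
    Function.Injective (Moduli.weight : Moduli R n → Setoid (Fin n) → R) := by
  rintro ⟨Γ, x⟩ ⟨Γ', x'⟩ h
  change Γ.weight x = Γ'.weight x' at h
  -- Both representatives are compared with the tree whose splits are exactly those of nonzero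
  -- weight.
  obtain ⟨Γ₀, h₀⟩ := Γ.exists_range_split_eq {e | x e ≠ 0}
  have key : ∀ (Δ : StableTree n) (y : Δ.Edge → R), Δ.weight y = Γ.weight x →
      Moduli.mk Δ y = Moduli.mk Γ₀ fun e => Γ.weight x (Γ₀.split e) := by
    intro Δ y hy
    refine StableTree.mk_eq_mk_of_range_subset ?_ ?_
    · rw [h₀]
      rintro _ ⟨e, he, rfl⟩
      by_contra hcon
      have := Δ.weight_eq_zero y hcon
      rw [hy, Γ.weight_split] at this
      exact he this
    · funext s
      rw [hy]
      by_cases hs : s ∈ Set.range Γ₀.split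
      · obtain ⟨e, rfl⟩ := hs
        rw [Γ₀.weight_split]
      · rw [Γ₀.weight_eq_zero _ hs]
        by_cases hs' : s ∈ Set.range Γ.split
        · obtain ⟨e, rfl⟩ := hs'
          rw [Γ.weight_split]
          by_contra hne
          exact hs (h₀ ▸ ⟨e, hne, rfl⟩)
        · exact Γ.weight_eq_zero _ hs'
  exact (key Γ x rfl).trans (key Γ' x' h.symm).symm

end Reconstruction

/-! ### Stable splits and trees with one or two edges -/

section SmallTrees

variable {n : ℕ}

/-- A partition of the legs in two parts with at least two elements each. -/
def IsSplit (s : Setoid (Fin n)) : Prop :=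
  ∃ g : Fin n → Bool, s = Setoid.ker g ∧ ∀ b, ∃ i j, i ≠ j ∧ g i = b ∧ g j = b

/-- Some part of `s` is disjoint from some part of `t`. -/
def Compat (s t : Setoid (Fin n)) : Prop :=
  ∃ i j, ∀ k, ¬ (s k i ∧ t k j)

theorem Compat.symm {s t : Setoid (Fin n)} : Compat s t → Compat t s := by
  rintro ⟨i, j, h⟩
  exact ⟨j, i, fun k hk => h k ⟨hk.2, hk.1⟩⟩

theorem IsSplit.compat_self {s : Setoid (Fin n)} (hs : IsSplit s) : Compat s s := by
  obtain ⟨g, rfl, h⟩ := hs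
  obtain ⟨i, -, -, hi, -⟩ := h true
  obtain ⟨j, -, -, hj, -⟩ := h false
  refine ⟨i, j, fun k hk => ?_⟩
  have h1 : g i = g j := (Eq.symm hk.1).trans hk.2
  rw [hi, hj] at h1
  exact absurd h1 (by decide)

theorem IsSplit.exists_ker {s : Setoid (Fin n)} (hs : IsSplit s) (i : Fin n) :
    ∃ g : Fin n → Bool, s = Setoid.ker g ∧ (∀ b, ∃ i j, i ≠ j ∧ g i = b ∧ g j = b) ∧
      g i = true := by
  obtain ⟨g, rfl, h⟩ := hs
  by_cases hi : g i = true
  · exact ⟨g, rfl, h, hi⟩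
  · refine ⟨fun k => !g k, ?_, fun b => ?_, by simpa using hi⟩
    · ext a b
      rw [Setoid.ker_def, Setoid.ker_def, Bool.not_inj_iff]
    · obtain ⟨a, c, hac, ha, hc⟩ := h (!b)
      exact ⟨a, c, hac, by simp [ha], by simp [hc]⟩

/-- A vertex on the given side is the median of three legs, and at least two of them lie on its side
of `e`. -/
theorem StableTree.isSplit_split (Γ : StableTree n) (e : Γ.Edge) : IsSplit (Γ.split e) := by
  refine ⟨_, rfl, fun b => ?_⟩
  obtain ⟨v, rfl⟩ : ∃ v, cut Γ.graph e.1 v = b := by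
    obtain ⟨⟨x, y⟩, hxy⟩ := e
    have h1 := cut_ne Γ.isTree hxy
    by_cases hx : cut Γ.graph s(x, y) x = b
    · exact ⟨x, hx⟩
    · exact ⟨y, bool_eq_of_ne h1.symm (Ne.symm hx)⟩
  obtain ⟨g, hg, hm⟩ := Γ.exists_median v
  have h1 := hm e.1 e.2 0 1 (by decide)
  have h2 := hm e.1 e.2 0 2 (by decide)
  have h3 := hm e.1 e.2 1 2 (by decide)
  rcases h1 with h1 | h1
  · rcases h3 with h3 | h3
    · exact ⟨_, _, hg.ne (by decide), h1, h3⟩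
    · exact ⟨_, _, hg.ne (by decide), h1, h3⟩
  · rcases h2 with h2 | h2
    · exact ⟨_, _, hg.ne (by decide), h1, h2⟩
    · exact ⟨_, _, hg.ne (by decide), h1, h2⟩

/-- Every side of an edge contains a leg, so an empty corner yields representatives of two disjoint
parts. -/
theorem StableTree.compat_split (Γ : StableTree n) (e f : Γ.Edge) :
    Compat (Γ.split e) (Γ.split f) := by
  by_cases hef : e = f
  · subst hef
    exact (Γ.isSplit_split e).compat_self
  · obtain ⟨β, β', h⟩ := exists_corner_empty Γ.isTree e.2 f.2 fun h => hef (Subtype.ext h)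
    have key : ∀ (e : Γ.Edge) β, ∃ i, cut Γ.graph e.1 (Γ.leg i) = β := by
      intro e β
      obtain ⟨g, hg, h⟩ := Γ.isSplit_split e
      rcases eq_or_eq_not_of_ker_eq hg with h1 | h1
      · obtain ⟨i, -, -, hi, -⟩ := h β
        exact ⟨i, (congrFun h1 i).trans hi⟩
      · obtain ⟨i, -, -, hi, -⟩ := h (!β)
        exact ⟨i, (congrFun h1 i).trans (by simp [hi])⟩
    obtain ⟨i, hi⟩ := key e β
    obtain ⟨j, hj⟩ := key f β'
    exact ⟨i, j, fun k hk => h (Γ.leg k) ⟨(show _ = _ from hk.1).trans hi,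
      (show _ = _ from hk.2).trans hj⟩⟩

theorem two_le_ncard {α : Type} [Finite α] {S : Set α} {i j : α} (hi : i ∈ S) (hj : j ∈ S)
    (h : i ≠ j) : 2 ≤ S.ncard :=
  (Set.one_lt_ncard (Set.toFinite _)).2 ⟨i, hi, j, hj, h⟩

theorem exists_tree_of_isSplit {s : Setoid (Fin n)} (hs : IsSplit s) :
    ∃ (Γ : StableTree n) (e : Γ.Edge), Γ.split e = s := by
  obtain ⟨g, rfl, h⟩ := hs
  have hcut : IsCut (⊤ : SimpleGraph (Fin 2)) s(0, 1) fun v => decide (v = 1) := by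
    intro u v huv
    revert u v
    decide
  have hedge : ∀ e ∈ (⊤ : SimpleGraph (Fin 2)).edgeSet, e = s(0, 1) := by
    rintro ⟨x, y⟩ hxy
    have : x ≠ y := ((SimpleGraph.mem_edgeSet _).1 hxy).ne
    revert x y
    decide
  let Γ : StableTree n :=
    { k := 2
      graph := ⊤
      isTree := isTree_of_isCut SimpleGraph.connected_top fun e he => by
        rw [hedge e he]
        exact ⟨_, hcut⟩
      leg := fun i => if g i then 1 else 0
      stable := by
        intro v
        have h1 : 0 < ((⊤ : SimpleGraph (Fin 2)).incidenceSet v).ncard := by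
          refine (Set.ncard_pos (Set.toFinite _)).2 ⟨s(v, v + 1), ?_, Sym2.mem_mk_left _ _⟩
          rw [SimpleGraph.mem_edgeSet, SimpleGraph.top_adj]
          revert v
          decide
        obtain ⟨i, j, hij, hi, hj⟩ := h (decide (v = 1))
        have h2 : 2 ≤ ((fun i => if g i then (1 : Fin 2) else 0) ⁻¹' {v}).ncard := by
          refine two_le_ncard (i := i) (j := j) ?_ ?_ hij
          · simp only [Set.mem_preimage, Set.mem_singleton_iff, hi]
            clear h1 hi hj
            revert v
            decide
          · simp only [Set.mem_preimage, Set.mem_singleton_iff, hj]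
            clear h1 hi hj
            revert v
            decide
        omega }
  let e : Γ.Edge := ⟨s(0, 1), by
    change (⊤ : SimpleGraph (Fin 2)).Adj 0 1
    decide⟩
  refine ⟨Γ, e, ?_⟩
  rw [← Γ.ker_eq_split (e := e) hcut]
  congr 1
  funext i
  change decide ((if g i then (1 : Fin 2) else 0) = 1) = g i
  cases g i <;> simp

/-- The path with three vertices. -/
def pathThree : SimpleGraph (Fin 3) where
  Adj x y := x ≠ y ∧ (x = 1 ∨ y = 1)
  symm := ⟨fun _ _ h => ⟨h.1.symm, h.2.symm⟩⟩
  loopless := ⟨fun _ h => h.1 rfl⟩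

theorem pathThree_adj {x y : Fin 3} : pathThree.Adj x y ↔ x ≠ y ∧ (x = 1 ∨ y = 1) := Iff.rfl

theorem isCut_pathThree {i : Fin 3} (hi : i ≠ 1) :
    IsCut pathThree s(i, 1) fun v => decide (v = i) := by
  intro u v huv
  rw [pathThree_adj] at huv
  revert i u v
  decide

theorem isTree_pathThree : pathThree.IsTree := by
  refine isTree_of_isCut ⟨fun x y => ?_⟩ ?_
  · have h : ∀ z, pathThree.Reachable z 1 := by
      intro z
      by_cases hz : z = 1
      · rw [hz]
      · exact SimpleGraph.Adj.reachable (pathThree_adj.2 ⟨hz, Or.inr rfl⟩)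
    exact (h x).trans (h y).symm
  · rintro ⟨x, y⟩ ⟨hne, rfl | rfl⟩
    · exact ⟨_, Sym2.eq_swap (a := (1 : Fin 3)) ▸ isCut_pathThree hne.symm⟩
    · exact ⟨_, isCut_pathThree hne⟩

/-- The tree is a path with three vertices. Its ends carry the two disjoint parts and its middle
vertex the remaining legs. -/
theorem exists_tree_of_compat {s t : Setoid (Fin n)} (hs : IsSplit s) (ht : IsSplit t)
    (hst : s ≠ t) (hc : Compat s t) :
    ∃ (Γ : StableTree n) (e f : Γ.Edge), Γ.split e = s ∧ Γ.split f = t := by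
  obtain ⟨i₀, j₀, hc⟩ := hc
  obtain ⟨g, rfl, hg, hi₀⟩ := hs.exists_ker i₀
  obtain ⟨h, rfl, hh, hj₀⟩ := ht.exists_ker j₀
  have hgh : ∀ k, g k = true → h k = false := by
    intro k hk
    by_contra hcon
    exact hc k ⟨hk.trans hi₀.symm, Eq.trans (by simpa using hcon) hj₀.symm⟩
  -- If no leg remained for the middle vertex, the two parts would be complementary and the splits
  -- equal.
  obtain ⟨m, hm, hm'⟩ : ∃ m, g m = false ∧ h m = false := by
    by_contra! hcon
    refine hst (Setoid.ext fun a b => ?_)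
    have : ∀ k, g k = !h k := by
      intro k
      have h1 := hgh k
      have h2 := hcon k
      revert h1 h2
      cases g k <;> cases h k <;> simp
    rw [Setoid.ker_def, Setoid.ker_def, this, this, Bool.not_inj_iff]
  let leg : Fin n → Fin 3 := fun k => if g k then 0 else if h k then 2 else 1
  have hleg0 : ∀ k, decide (leg k = 0) = g k := by
    intro k
    rcases hgk : g k <;> rcases hhk : h k <;> simp [leg, hgk, hhk]
  have hleg2 : ∀ k, decide (leg k = 2) = h k := by
    intro k
    have := hgh k
    rcases hgk : g k <;> rcases hhk : h k <;> simp_all [leg]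
  let Γ : StableTree n :=
    { k := 3
      graph := pathThree
      isTree := isTree_pathThree
      leg := leg
      stable := by
        have hend : ∀ i : Fin 3, i ≠ 1 → 0 < (pathThree.incidenceSet i).ncard := fun i hi =>
          (Set.ncard_pos (Set.toFinite _)).2 ⟨s(i, 1), pathThree_adj.2 ⟨hi, Or.inr rfl⟩,
            Sym2.mem_mk_left _ _⟩
        intro v
        obtain rfl | rfl | rfl : v = 0 ∨ v = 1 ∨ v = 2 := by revert v; decide
        · obtain ⟨i, j, hij, hi, hj⟩ := hg true
          rw [← hleg0, decide_eq_true_iff] at hi hj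
          have h1 := hend 0 (by decide)
          have h2 : 2 ≤ (leg ⁻¹' {0}).ncard :=
            two_le_ncard hi hj hij
          omega
        · have h1 : 2 ≤ (pathThree.incidenceSet 1).ncard :=
            two_le_ncard (i := s(0, 1)) (j := s(2, 1))
              ⟨pathThree_adj.2 (by decide), Sym2.mem_mk_right _ _⟩
              ⟨pathThree_adj.2 (by decide), Sym2.mem_mk_right _ _⟩ (by decide)
          have h2 : 0 < (leg ⁻¹' {1}).ncard :=
            (Set.ncard_pos (Set.toFinite _)).2 ⟨m, by simp [leg, hm, hm']⟩
          omega
        · obtain ⟨i, j, hij, hi, hj⟩ := hh true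
          rw [← hleg2, decide_eq_true_iff] at hi hj
          have h1 := hend 2 (by decide)
          have h2 : 2 ≤ (leg ⁻¹' {2}).ncard :=
            two_le_ncard hi hj hij
          omega }
  have h01 : pathThree.Adj 0 1 := pathThree_adj.2 (by decide)
  have h21 : pathThree.Adj 2 1 := pathThree_adj.2 (by decide)
  let e : Γ.Edge := ⟨s((0 : Fin 3), 1), h01⟩
  let f : Γ.Edge := ⟨s((2 : Fin 3), 1), h21⟩
  refine ⟨Γ, e, f, ?_, ?_⟩
  · rw [← Γ.ker_eq_split (e := e) (isCut_pathThree h01.ne)]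
    exact congrArg _ (funext hleg0)
  · rw [← Γ.ker_eq_split (e := f) (isCut_pathThree h21.ne)]
    exact congrArg _ (funext hleg2)

end SmallTrees

/-! ### Piecewise linear bijections of the moduli space -/

section Linear

variable {n : ℕ} {R : Type} [CommSemiring R]

/-- The restriction to each cone is given by a matrix of natural numbers. -/
def IsNatLinear (f : Moduli R n → Moduli R n) : Prop :=
  ∀ Γ : StableTree n, ∃ (Γ' : StableTree n) (T : Γ'.Edge → Γ.Edge → ℕ),
    ∀ x, f (Moduli.mk Γ x) = Moduli.mk Γ' fun e' => ∑ e, (T e' e : R) * x e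

open Classical in
/-- The weight function of the point of weight one on the ray of a split. -/
noncomputable def unitWeight (s : Setoid (Fin n)) : Setoid (Fin n) → ℕ := Pi.single s 1

theorem unitWeight_self (s : Setoid (Fin n)) : unitWeight s s = 1 := by
  simp [unitWeight]

theorem unitWeight_of_ne {s t : Setoid (Fin n)} (h : t ≠ s) : unitWeight s t = 0 := by
  simp [unitWeight, h]

theorem StableTree.weight_natCast (Γ : StableTree n) (N : Γ.Edge → ℕ) (s : Setoid (Fin n)) :
    Γ.weight (fun e => (N e : R)) s = (Γ.weight N s : ℕ) := by
  simp [StableTree.weight]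

open Classical in
theorem StableTree.weight_single (Γ : StableTree n) (e : Γ.Edge) :
    Γ.weight (Pi.single e 1) = unitWeight (Γ.split e) := by
  funext s
  by_cases hs : s ∈ Set.range Γ.split
  · obtain ⟨f, rfl⟩ := hs
    rw [Γ.weight_split]
    by_cases hf : f = e
    · rw [hf, unitWeight_self, Pi.single_eq_same]
    · rw [unitWeight_of_ne (Γ.split_injective.ne hf), Pi.single_eq_of_ne hf]
  · rw [Γ.weight_eq_zero _ hs, unitWeight_of_ne]
    rintro rfl
    exact hs ⟨e, rfl⟩

theorem IsNatLinear.exists_weight {f : Moduli R n → Moduli R n} (hf : IsNatLinear f)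
    (Γ : StableTree n) : ∃ M : Γ.Edge → Setoid (Fin n) → ℕ, ∀ x s,
      (f (Moduli.mk Γ x)).weight s = ∑ e, (M e s : R) * x e := by
  classical
  obtain ⟨Γ', T, hT⟩ := hf Γ
  refine ⟨fun e => Γ'.weight fun e' => T e' e, fun x s => ?_⟩
  rw [hT, Moduli.weight_mk]
  by_cases hs : s ∈ Set.range Γ'.split
  · obtain ⟨e', rfl⟩ := hs
    rw [Γ'.weight_split]
    refine Finset.sum_congr rfl fun e _ => ?_
    beta_reduce
    rw [Γ'.weight_split]
  · rw [Γ'.weight_eq_zero _ hs]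
    refine (Finset.sum_eq_zero fun e _ => ?_).symm
    beta_reduce
    rw [Γ'.weight_eq_zero _ hs, Nat.cast_zero, zero_mul]

/-- A stable split. -/
abbrev Split (n : ℕ) : Type := {s : Setoid (Fin n) // IsSplit s}

theorem Split.exists_point (R : Type) [CommSemiring R] (s : Split n) :
    ∃ p : Moduli R n, ∀ t, p.weight t = (unitWeight s.1 t : R) := by
  classical
  obtain ⟨Γ, e, he⟩ := exists_tree_of_isSplit s.2
  refine ⟨Moduli.mk Γ fun f => ((Pi.single e 1 : Γ.Edge → ℕ) f : R), fun t => ?_⟩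
  rw [Moduli.weight_mk, Γ.weight_natCast, Γ.weight_single, he]

/-- The point of weight one on the ray of a split. -/
noncomputable def Split.point (R : Type) [CommSemiring R] (s : Split n) : Moduli R n :=
  (s.exists_point R).choose

theorem Split.weight_point (s : Split n) (t : Setoid (Fin n)) :
    (s.point R).weight t = (unitWeight s.1 t : R) :=
  (s.exists_point R).choose_spec t

/-- The stable split of an edge. -/
noncomputable def StableTree.stableSplit (Γ : StableTree n) (e : Γ.Edge) : Split n :=
  ⟨Γ.split e, Γ.isSplit_split e⟩

open Classical in
theorem StableTree.mk_single (Γ : StableTree n) (e : Γ.Edge) :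
    Moduli.mk Γ (fun f => ((Pi.single e 1 : Γ.Edge → ℕ) f : R)) = (Γ.stableSplit e).point R := by
  refine Moduli.weight_injective (funext fun t => ?_)
  rw [Split.weight_point, Moduli.weight_mk, Γ.weight_natCast, Γ.weight_single]
  rfl

/-- The entries of the matrix on a cone are read off at the ray generators, and these do not depend
on the cone containing them. -/
theorem IsNatLinear.weight_eq {f : Moduli R n → Moduli R n} (hf : IsNatLinear f)
    (Γ : StableTree n) (x : Γ.Edge → R) (s : Setoid (Fin n)) :
    (f (Moduli.mk Γ x)).weight s = ∑ e, (f ((Γ.stableSplit e).point R)).weight s * x e := by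
  classical
  obtain ⟨M, hM⟩ := hf.exists_weight Γ
  rw [hM]
  refine Finset.sum_congr rfl fun e _ => ?_
  rw [← Γ.mk_single, hM, Finset.sum_eq_single e]
  · simp
  · intro b _ hb
    simp [Pi.single_eq_of_ne hb]
  · simp

/-- A piecewise linear map is determined by the images of the rays. -/
theorem IsNatLinear.ext {f g : Moduli R n → Moduli R n} (hf : IsNatLinear f) (hg : IsNatLinear g)
    (h : ∀ s : Split n, f (s.point R) = g (s.point R)) : f = g := by
  funext p
  obtain ⟨Γ, x⟩ := p
  refine Moduli.weight_injective (funext fun s => ?_)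
  refine (hf.weight_eq Γ x s).trans (Eq.trans ?_ (hg.weight_eq Γ x s).symm)
  simp only [h]

theorem Split.point_injective [CharZero R] :
    Function.Injective (Split.point R : Split n → Moduli R n) := by
  intro s t h
  have h1 := s.weight_point (R := R) s.1
  rw [h, t.weight_point, unitWeight_self] at h1
  by_contra hne
  rw [unitWeight_of_ne fun h => hne (Subtype.ext h)] at h1
  simp at h1

/-- A unit vector over `ℕ` is indecomposable: a natural combination of nonzero vectors equal to it
has a single term, with coefficient one. -/
theorem exists_of_sum_mul_eq_unit {ι κ : Type} [Fintype ι] {N : ι → ℕ} {M : ι → κ → ℕ} {s : κ}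
    (hs : ∑ i, M i s * N i = 1) (hne : ∀ t, t ≠ s → ∑ i, M i t * N i = 0)
    (hM : ∀ i, ∃ t, M i t ≠ 0) : ∃ i, N i = 1 ∧ ∀ j, j ≠ i → N j = 0 := by
  classical
  obtain ⟨i, -, hi⟩ := Finset.exists_ne_zero_of_sum_ne_zero (hs.trans_ne one_ne_zero)
  have hsum := Finset.add_sum_erase Finset.univ (fun i => M i s * N i) (Finset.mem_univ i)
  simp only [hs] at hsum
  refine ⟨i, ?_, fun j hj => ?_⟩
  · have h1 : M i s * N i = 1 := by omega
    exact Nat.eq_one_of_mul_eq_one_left h1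
  · have h1 : ∑ k ∈ Finset.univ.erase i, M k s * N k = 0 := by omega
    have h2 := Finset.sum_eq_zero_iff.1 h1 j (by simp [hj])
    obtain ⟨t, ht⟩ := hM j
    by_cases hts : t = s
    · subst hts
      exact (Nat.mul_eq_zero.1 h2).resolve_left ht
    · have h3 := Finset.sum_eq_zero_iff.1 (hne t hts) j (Finset.mem_univ _)
      exact (Nat.mul_eq_zero.1 h3).resolve_left ht

/-- Write the image of a ray generator as a natural combination of the generators of some cone.
Applying the inverse expresses a unit vector as the same combination of their nonzero images, so
only one generator occurs. -/
theorem IsNatLinear.exists_map_point [CharZero R] {f : Equiv.Perm (Moduli R n)}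
    (hf : IsNatLinear f) (hf' : IsNatLinear f.symm) (s : Split n) :
    ∃ t : Split n, f (s.point R) = t.point R := by
  classical
  obtain ⟨Γ, e, he⟩ := exists_tree_of_isSplit s.2
  obtain ⟨Γ', T, hT⟩ := hf Γ
  obtain ⟨M, hM⟩ := hf'.exists_weight Γ'
  have hs : s = Γ.stableSplit e := Subtype.ext he.symm
  have h1 : f (s.point R) = Moduli.mk Γ' fun e' => (T e' e : R) := by
    rw [hs, ← Γ.mk_single, hT]
    congr 1
    funext e'
    rw [Finset.sum_eq_single e]
    · simp
    · intro b _ hb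
      simp [Pi.single_eq_of_ne hb]
    · simp
  have h2 : ∀ t, unitWeight s.1 t = ∑ e', M e' t * T e' e := by
    intro t
    have h3 := hM (fun e' => (T e' e : R)) t
    rw [← h1, Equiv.symm_apply_apply, Split.weight_point] at h3
    exact_mod_cast h3
  -- A zero row would make the injective map `f.symm` agree at a ray generator and at the apex.
  have h4 : ∀ e', ∃ t, M e' t ≠ 0 := by
    intro e'
    by_contra! hcon
    have h5 : Moduli.mk Γ' (fun f => ((Pi.single e' 1 : Γ'.Edge → ℕ) f : R)) =
        Moduli.mk Γ' fun _ => 0 := by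
      refine f.symm.injective (Moduli.weight_injective (funext fun t => ?_))
      rw [hM, hM, Finset.sum_eq_single e']
      · simp [hcon]
      · intro b _ hb
        simp [Pi.single_eq_of_ne hb]
      · simp
    have h6 := congrArg (fun p => p.weight (Γ'.split e')) h5
    simp only [Moduli.weight_mk, Γ'.weight_split] at h6
    simp at h6
  obtain ⟨e', he', hne⟩ := exists_of_sum_mul_eq_unit
    ((h2 s.1).symm.trans (unitWeight_self _))
    (fun t ht => (h2 t).symm.trans (unitWeight_of_ne ht)) h4
  refine ⟨Γ'.stableSplit e', ?_⟩
  rw [h1, ← Γ'.mk_single]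
  congr 1
  funext b
  by_cases hb : b = e'
  · rw [hb, he', Pi.single_eq_same]
  · rw [hne b hb, Pi.single_eq_of_ne hb]

/-- A piecewise linear bijection permutes the rays. -/
theorem IsNatLinear.exists_perm [CharZero R] {f : Equiv.Perm (Moduli R n)}
    (hf : IsNatLinear f) (hf' : IsNatLinear f.symm) :
    ∃ π : Equiv.Perm (Split n), ∀ s, f (s.point R) = (π s).point R := by
  choose π hπ using hf.exists_map_point hf'
  choose ρ hρ using IsNatLinear.exists_map_point (f := f.symm) hf' hf
  refine ⟨⟨π, ρ, fun s => ?_, fun s => ?_⟩, hπ⟩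
  · refine Split.point_injective (R := R) ?_
    rw [← hρ, ← hπ, Equiv.symm_apply_apply]
  · refine Split.point_injective (R := R) ?_
    rw [← hπ, ← hρ, Equiv.apply_symm_apply]

/-- Compatible splits lie in a common cone, which `f` sends into a single cone, so the image splits
belong to one tree. -/
theorem IsNatLinear.compat [CharZero R] {f : Moduli R n → Moduli R n} (hf : IsNatLinear f)
    {s t s' t' : Split n} (hs : f (s.point R) = s'.point R) (ht : f (t.point R) = t'.point R)
    (h : Compat s.1 t.1) : Compat s'.1 t'.1 := by
  classical
  by_cases hst : s = t
  · subst hst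
    rw [← Split.point_injective (hs.symm.trans ht)]
    exact s'.2.compat_self
  obtain ⟨Γ, a, b, ha, hb⟩ := exists_tree_of_compat s.2 t.2 (fun h => hst (Subtype.ext h)) h
  have hsa : Γ.stableSplit a = s := Subtype.ext ha
  have htb : Γ.stableSplit b = t := Subtype.ext hb
  obtain ⟨Γ', T, hT⟩ := hf Γ
  have key : ∀ (c : Γ.Edge) (r r' : Split n), Γ.stableSplit c = r →
      f (r.point R) = r'.point R → r'.1 ∈ Set.range Γ'.split := by
    intro c r r' hc hr
    by_contra hcon
    have h1 := hT fun e => ((Pi.single c 1 : Γ.Edge → ℕ) e : R)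
    rw [Γ.mk_single, hc, hr] at h1
    have h2 := r'.weight_point (R := R) r'.1
    rw [h1, Moduli.weight_mk, Γ'.weight_eq_zero _ hcon, unitWeight_self] at h2
    simp at h2
  obtain ⟨a', ha'⟩ := key a s s' hsa hs
  obtain ⟨b', hb'⟩ := key b t t' htb ht
  rw [← ha', ← hb']
  exact Γ'.compat_split a' b'

theorem weight_mk_zero (Γ : StableTree n) : (Moduli.mk Γ fun _ => (0 : R)).weight = 0 := by
  funext s
  rw [Moduli.weight_mk]
  simp [StableTree.weight]

/-! ### Permutations of the legs -/

/-- The action of a permutation of the legs on splits. -/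
def Split.permute (σ : Equiv.Perm (Fin n)) (s : Split n) : Split n :=
  ⟨Setoid.comap σ.symm s.1, by
    obtain ⟨g, hg, h⟩ := s.2
    refine ⟨g ∘ σ.symm, ?_, fun b => ?_⟩
    · rw [hg]
      rfl
    · obtain ⟨i, j, hij, hi, hj⟩ := h b
      exact ⟨σ i, σ j, σ.injective.ne hij, by simp [hi], by simp [hj]⟩⟩

theorem Split.permute_rel (σ : Equiv.Perm (Fin n)) (s : Split n) (i j : Fin n) :
    (s.permute σ).1 (σ i) (σ j) ↔ s.1 i j := by
  change s.1 (σ.symm (σ i)) (σ.symm (σ j)) ↔ _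
  rw [Equiv.symm_apply_apply, Equiv.symm_apply_apply]

theorem isNatLinear_permuteMap (σ : Equiv.Perm (Fin n)) :
    IsNatLinear (permuteMap R σ : Moduli R n → Moduli R n) := by
  classical
  intro Γ
  refine ⟨Γ.permute σ, fun e' e => if e' = e then 1 else 0, fun x => ?_⟩
  change Moduli.mk (Γ.permute σ) x = _
  congr 1
  funext e'
  refine ((Finset.sum_eq_single (M := R) e' (fun b _ hb => ?_) (by simp)).trans ?_).symm
  · exact (congrArg (fun k : ℕ => (k : R) * x b) (if_neg (Ne.symm hb))).trans (by simp)
  · exact (congrArg (fun k : ℕ => (k : R) * x e') (if_pos rfl)).trans (by simp)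

theorem permuteMap_point (σ : Equiv.Perm (Fin n)) (s : Split n) :
    permuteMap R σ (s.point R) = (s.permute σ).point R := by
  classical
  obtain ⟨Γ, e, he⟩ := exists_tree_of_isSplit s.2
  have hs : s = Γ.stableSplit e := Subtype.ext he.symm
  have hs' : s.permute σ = (Γ.permute σ).stableSplit e := by
    rw [hs]
    rfl
  rw [hs', hs, ← Γ.mk_single]
  exact (Γ.permute σ).mk_single (R := R) e

theorem permuteMap_eq_id_iff [CharZero R] (σ : Equiv.Perm (Fin n)) :
    permuteMap R σ = id ↔ ∀ s : Split n, s.permute σ = s := by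
  constructor
  · intro h s
    refine Split.point_injective (R := R) ?_
    rw [← permuteMap_point, h, id]
  · intro h
    rw [← permuteMap_one]
    refine (isNatLinear_permuteMap σ).ext (isNatLinear_permuteMap 1) fun s => ?_
    rw [permuteMap_point, h, permuteMap_one, id]

end Linear

/-! ### Automorphisms of the compatibility graph of splits -/

section Compatibility

variable {n : ℕ}

theorem Split.rel_of_not_rel (s : Split n) {i j k : Fin n} (hi : ¬ s.1 i k) (hj : ¬ s.1 j k) :
    s.1 i j := by
  obtain ⟨g, hg, -⟩ := s.2
  rw [hg, Setoid.ker_def] at hi hj ⊢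
  exact bool_eq_of_ne hi hj

theorem Split.exists_not_rel (s : Split n) (i : Fin n) : ∃ j, ¬ s.1 j i := by
  obtain ⟨g, hg, h⟩ := s.2
  obtain ⟨j, -, -, hj, -⟩ := h (!g i)
  refine ⟨j, ?_⟩
  rw [hg, Setoid.ker_def, hj]
  simp

theorem Split.exists_rel_ne (s : Split n) (i : Fin n) : ∃ j, j ≠ i ∧ s.1 j i := by
  obtain ⟨g, hg, h⟩ := s.2
  obtain ⟨j, k, hjk, hj, hk⟩ := h (g i)
  by_cases hji : j = i
  · exact ⟨k, fun h => hjk (hji.trans h.symm), by rw [hg, Setoid.ker_def, hk]⟩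
  · exact ⟨j, hji, by rw [hg, Setoid.ker_def, hj]⟩

/-- Compatibility means that one of the parts of `s` lies in a part of `u`. -/
theorem compat_iff {s u : Split n} :
    Compat s.1 u.1 ↔ ∃ a, ∀ i j, s.1 i a → s.1 j a → u.1 i j := by
  constructor
  · rintro ⟨a, c, h⟩
    exact ⟨a, fun i j hi hj => u.rel_of_not_rel (k := c) (fun h' => h i ⟨hi, h'⟩)
      fun h' => h j ⟨hj, h'⟩⟩
  · rintro ⟨a, h⟩
    obtain ⟨c, hc⟩ := u.exists_not_rel a
    refine ⟨a, c, fun k hk => hc ?_⟩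
    exact u.1.trans (u.1.symm hk.2) (h k a hk.1 (s.1.refl a))

/-- The two-element sets of legs. -/
abbrev Pair (n : ℕ) : Type := {A : Finset (Fin n) // A.card = 2}

/-- The two-element set with elements `i` and `j`. -/
def Pair.mk {i j : Fin n} (h : i ≠ j) : Pair n := ⟨{i, j}, Finset.card_pair h⟩

theorem Pair.mem_mk {i j k : Fin n} (h : i ≠ j) : k ∈ (Pair.mk h).1 ↔ k = i ∨ k = j := by
  simp [Pair.mk]

theorem Pair.eq_mk {A : Pair n} {i j : Fin n} (hi : i ∈ A.1) (hj : j ∈ A.1) (h : i ≠ j) :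
    A = Pair.mk h := by
  refine Subtype.ext (Finset.eq_of_subset_of_card_le ?_ ?_).symm
  · intro k hk
    rcases (Pair.mem_mk h).1 hk with rfl | rfl
    · exact hi
    · exact hj
  · rw [A.2, (Pair.mk h).2]

theorem Pair.exists_eq_mk {A : Pair n} {i : Fin n} (hi : i ∈ A.1) :
    ∃ j, ∃ h : i ≠ j, A = Pair.mk h := by
  obtain ⟨j, hj, hne⟩ := Finset.exists_mem_ne (by rw [A.2]; decide) i
  exact ⟨j, hne.symm, Pair.eq_mk hi hj hne.symm⟩

theorem Pair.nonempty (A : Pair n) : A.1.Nonempty := by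
  rw [← Finset.card_pos, A.2]
  decide

theorem exists_notMem_of_card_lt (S : Finset (Fin n)) (h : S.card < n) : ∃ x, x ∉ S := by
  by_contra! hcon
  rw [Finset.eq_univ_of_forall hcon, Finset.card_univ, Fintype.card_fin] at h
  exact lt_irrefl _ h

/-- The split that separates a pair of legs from the other legs. -/
def Pair.split (hn : 5 ≤ n) (A : Pair n) : Split n :=
  ⟨Setoid.ker fun i => decide (i ∈ A.1), _, rfl, by
    have h : ∀ S : Finset (Fin n), 2 ≤ S.card → ∃ i j, i ≠ j ∧ i ∈ S ∧ j ∈ S := by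
      intro S hS
      obtain ⟨i, hi, j, hj, hij⟩ := Finset.one_lt_card.1 hS
      exact ⟨i, j, hij, hi, hj⟩
    rintro (_ | _)
    · obtain ⟨i, j, hij, hi, hj⟩ := h A.1ᶜ (by
        rw [Finset.card_compl, A.2, Fintype.card_fin]; omega)
      exact ⟨i, j, hij, by simpa using hi, by simpa using hj⟩
    · obtain ⟨i, j, hij, hi, hj⟩ := h A.1 A.2.ge
      exact ⟨i, j, hij, by simpa using hi, by simpa using hj⟩⟩

theorem Pair.split_rel (hn : 5 ≤ n) (A : Pair n) (i j : Fin n) :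
    (A.split hn).1 i j ↔ (i ∈ A.1 ↔ j ∈ A.1) :=
  decide_eq_decide

theorem Pair.split_injective (hn : 5 ≤ n) : Function.Injective (Pair.split hn) := by
  intro A B h
  -- Two pairs cover at most four of the at least five legs; a leg outside both identifies the pairs
  -- among the parts.
  obtain ⟨c, hc⟩ := exists_notMem_of_card_lt (A.1 ∪ B.1) (by
    have := Finset.card_union_le A.1 B.1
    rw [A.2, B.2] at this
    omega)
  rw [Finset.mem_union, not_or] at hc
  refine Subtype.ext (Finset.ext fun k => ?_)
  have h1 := A.split_rel hn k c
  rw [h, B.split_rel] at h1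
  tauto

theorem Pair.compat_iff (hn : 5 ≤ n) (A : Pair n) (s : Split n) :
    Compat (A.split hn).1 s.1 ↔ ∀ i ∈ A.1, ∀ j ∈ A.1, s.1 i j := by
  rw [TropModuli.compat_iff]
  constructor
  · rintro ⟨a, h⟩ i hi j hj
    by_cases ha : a ∈ A.1
    · exact h i j ((A.split_rel hn _ _).2 (by tauto)) ((A.split_rel hn _ _).2 (by tauto))
    -- Here the complement of `A` lies in one part of `s`. The other part has at least two elements
    -- and lies in `A`, so it is `A`.
    · obtain ⟨c, hc⟩ := s.exists_not_rel a
      obtain ⟨d, hd, hdc⟩ := s.exists_rel_ne c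
      have key : ∀ k, ¬ s.1 k a → k ∈ A.1 := by
        intro k hk
        by_contra hkA
        exact hk (h k a ((A.split_rel hn _ _).2 (by tauto)) ((A.split_rel hn _ _).2 Iff.rfl))
      have hA := Pair.eq_mk (key c hc) (key d fun h => hc (s.1.trans (s.1.symm hdc) h)) hd.symm
      have hall : ∀ k ∈ A.1, s.1 k c := by
        intro k hk
        rw [hA, Pair.mem_mk] at hk
        rcases hk with rfl | rfl
        · exact s.1.refl _
        · exact hdc
      exact s.1.trans (hall i hi) (s.1.symm (hall j hj))
  · intro h
    obtain ⟨a, ha⟩ := A.nonempty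
    refine ⟨a, fun i j hi hj => ?_⟩
    rw [A.split_rel] at hi hj
    exact h i (hi.2 ha) j (hj.2 ha)

theorem Pair.compat_mk_iff (hn : 5 ≤ n) {i j : Fin n} (h : i ≠ j) (s : Split n) :
    Compat ((Pair.mk h).split hn).1 s.1 ↔ s.1 i j := by
  rw [Pair.compat_iff]
  simp only [Pair.mem_mk]
  constructor
  · exact fun h => h i (Or.inl rfl) j (Or.inr rfl)
  · rintro h a (rfl | rfl) b (rfl | rfl)
    · exact s.1.refl _
    · exact h
    · exact s.1.symm h
    · exact s.1.refl _

theorem Pair.compat_split_iff (hn : 5 ≤ n) (A B : Pair n) :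
    Compat (A.split hn).1 (B.split hn).1 ↔ A = B ∨ Disjoint A.1 B.1 := by
  rw [Pair.compat_iff]
  simp only [Pair.split_rel]
  constructor
  · intro h
    by_cases hd : Disjoint A.1 B.1
    · exact Or.inr hd
    · obtain ⟨i, hi, hi'⟩ := Finset.not_disjoint_iff.1 hd
      refine Or.inl (Subtype.ext (Finset.eq_of_subset_of_card_le (fun j hj => ?_) ?_))
      · exact (h i hi j hj).1 hi'
      · rw [A.2, B.2]
  · rintro (rfl | hd) i hi j hj
    · tauto
    · exact iff_of_false (Finset.disjoint_left.1 hd hi) (Finset.disjoint_left.1 hd hj)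

/-- The splits compatible with `s` form a join. -/
def LinkIsJoin (s : Split n) : Prop :=
  ∃ P : Split n → Prop, (∃ a, a ≠ s ∧ Compat s.1 a.1 ∧ P a) ∧
    (∃ b, b ≠ s ∧ Compat s.1 b.1 ∧ ¬ P b) ∧
    ∀ t u : Split n, t ≠ s → u ≠ s → Compat s.1 t.1 → Compat s.1 u.1 → P t → ¬ P u → Compat t.1 u.1

theorem LinkIsJoin.of_perm {π : Equiv.Perm (Split n)}
    (hπ : ∀ s t : Split n, Compat (π s).1 (π t).1 ↔ Compat s.1 t.1) {s : Split n}
    (h : LinkIsJoin (π s)) : LinkIsJoin s := by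
  obtain ⟨P, ⟨a, ha, hsa, hPa⟩, ⟨b, hb, hsb, hPb⟩, h⟩ := h
  obtain ⟨a, rfl⟩ := π.surjective a
  obtain ⟨b, rfl⟩ := π.surjective b
  refine ⟨P ∘ π, ⟨a, fun h => ha (by rw [h]), (hπ _ _).1 hsa, hPa⟩,
    ⟨b, fun h => hb (by rw [h]), (hπ _ _).1 hsb, hPb⟩, fun t u ht hu hst hsu hPt hPu => ?_⟩
  exact (hπ _ _).1 (h _ _ (π.injective.ne ht) (π.injective.ne hu) ((hπ _ _).2 hst)
    ((hπ _ _).2 hsu) hPt hPu)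

/-- Both parts of `s` have at least three elements. A split compatible with `s` leaves one of the
parts uncut, and a split that leaves one part uncut is compatible with any split that leaves the
other uncut. Pairs inside the two parts show that both classes are inhabited. -/
theorem linkIsJoin_of_forall_ne (hn : 5 ≤ n) {s : Split n} (hs : ∀ A : Pair n, s ≠ A.split hn) :
    LinkIsJoin s := by
  have hthree : ∀ i, ∃ j k, i ≠ j ∧ i ≠ k ∧ j ≠ k ∧ s.1 j i ∧ s.1 k i := by
    intro i
    obtain ⟨j, hji, hj⟩ := s.exists_rel_ne i
    by_contra! hcon
    refine hs (Pair.mk hji.symm) (Subtype.ext (Setoid.ext fun a b => ?_))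
    have key : ∀ a, s.1 a i ↔ a ∈ (Pair.mk hji.symm).1 := by
      intro a
      rw [Pair.mem_mk]
      constructor
      · intro ha
        by_contra! hne
        exact hcon j a hji.symm hne.1.symm hne.2.symm hj ha
      · rintro (rfl | rfl)
        · exact s.1.refl _
        · exact hj
    rw [Pair.split_rel, ← key, ← key]
    constructor
    · intro h
      exact ⟨fun h' => s.1.trans (s.1.symm h) h', fun h' => s.1.trans h h'⟩
    · intro h
      by_cases ha : s.1 a i
      · exact s.1.trans ha (s.1.symm (h.1 ha))
      · exact s.rel_of_not_rel ha fun hb => ha (h.2 hb)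
  have hpair : ∀ {i j k : Fin n} (hij : i ≠ j), i ≠ k → j ≠ k → s.1 j i → s.1 k i →
      (Pair.mk hij).split hn ≠ s ∧ ¬ ((Pair.mk hij).split hn).1 k i ∧
      ∀ a b, ¬ s.1 a i → ¬ s.1 b i → ((Pair.mk hij).split hn).1 a b := by
    intro i j k hij hik hjk hj hk
    have h1 : ¬ ((Pair.mk hij).split hn).1 k i := by
      rw [Pair.split_rel, Pair.mem_mk, Pair.mem_mk]
      simp [hik.symm, hjk.symm]
    refine ⟨fun h => h1 (h ▸ hk), h1, fun a b ha hb => ?_⟩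
    rw [Pair.split_rel, Pair.mem_mk, Pair.mem_mk]
    refine iff_of_false ?_ ?_
    · rintro (rfl | rfl)
      · exact ha (s.1.refl _)
      · exact ha hj
    · rintro (rfl | rfl)
      · exact hb (s.1.refl _)
      · exact hb hj
  obtain ⟨p⟩ : Nonempty (Fin n) := ⟨⟨0, by omega⟩⟩
  obtain ⟨q, hq⟩ := s.exists_not_rel p
  have hq' : ∀ a, ¬ s.1 a p ↔ s.1 a q := fun a =>
    ⟨fun ha => s.rel_of_not_rel ha hq, fun ha h => hq (s.1.trans (s.1.symm ha) h)⟩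
  have hp' : ∀ a, ¬ s.1 a q ↔ s.1 a p := fun a => by rw [← hq', not_not]
  obtain ⟨j, k, hpj, hpk, hjk, hj, hk⟩ := hthree p
  obtain ⟨j', k', hqj, hqk, hjk', hj', hk'⟩ := hthree q
  obtain ⟨h1, h2, h3⟩ := hpair hpj hpk hjk hj hk
  obtain ⟨h4, h5, h6⟩ := hpair hqj hqk hjk' hj' hk'
  -- The two classes are told apart by whether the part of `q` stays uncut.
  refine ⟨fun t => ∀ a b, s.1 a q → s.1 b q → t.1 a b, ⟨_, h1, ?_, ?_⟩, ⟨_, h4, ?_, ?_⟩, ?_⟩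
  · exact compat_iff.2 ⟨q, fun a b ha hb => h3 a b ((hq' a).2 ha) ((hq' b).2 hb)⟩
  · exact fun a b ha hb => h3 a b ((hq' a).2 ha) ((hq' b).2 hb)
  · exact compat_iff.2 ⟨p, fun a b ha hb => h6 a b ((hp' a).2 ha) ((hp' b).2 hb)⟩
  · exact fun h => h5 (h _ _ hk' (s.1.refl q))
  · intro t u _ _ _ hsu hPt hPu
    obtain ⟨c, hc⟩ := compat_iff.1 hsu
    have hcp : s.1 c p := by
      by_contra hcp
      have hcq := (hq' c).1 hcp
      exact hPu fun a b ha hb => hc a b (s.1.trans ha (s.1.symm hcq))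
        (s.1.trans hb (s.1.symm hcq))
    obtain ⟨x, hx⟩ := t.exists_not_rel q
    obtain ⟨y, hy⟩ := u.exists_not_rel p
    refine ⟨x, y, fun m hm => ?_⟩
    by_cases hmp : s.1 m p
    · exact hy (u.1.trans (u.1.symm hm.2)
        (hc m p (s.1.trans hmp (s.1.symm hcp)) (s.1.symm hcp)))
    · exact hx (t.1.trans (t.1.symm hm.1) (hPt m q ((hq' m).1 hmp) (s.1.refl q)))

/-- The incompatibility graph on the link is connected, so no property as in `LinkIsJoin` can
distinguish its members. Pairs outside `A` are joined through pairs meeting both, and every member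
of the link is tied to such a pair. -/
theorem Pair.not_linkIsJoin (hn : 5 ≤ n) (A : Pair n) : ¬ LinkIsJoin (A.split hn) := by
  rintro ⟨P, ⟨a, ha, hsa, hPa⟩, ⟨b, hb, hsb, hPb⟩, h⟩
  have hiff : ∀ t u : Split n, t ≠ A.split hn → u ≠ A.split hn → Compat (A.split hn).1 t.1 →
      Compat (A.split hn).1 u.1 → ¬ Compat t.1 u.1 → (P t ↔ P u) := by
    intro t u ht hu hst hsu htu
    by_contra hcon
    rw [not_iff, iff_iff_and_or_not_and_not] at hcon
    rcases hcon with ⟨h1, h2⟩ | ⟨h1, h2⟩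
    · exact htu (h u t hu ht hsu hst h2 h1).symm
    · exact htu (h t u ht hu hst hsu (not_not.1 h1) h2)
  have hlink : ∀ B : Pair n, Disjoint A.1 B.1 →
      B.split hn ≠ A.split hn ∧ Compat (A.split hn).1 (B.split hn).1 := by
    intro B hB
    refine ⟨fun h => ?_, (Pair.compat_split_iff hn A B).2 (Or.inr hB)⟩
    rw [Pair.split_injective hn h, disjoint_self, Finset.bot_eq_empty] at hB
    exact A.nonempty.ne_empty hB
  have hmeet : ∀ B B' : Pair n, Disjoint A.1 B.1 → Disjoint A.1 B'.1 → ¬ Disjoint B.1 B'.1 →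
      (P (B.split hn) ↔ P (B'.split hn)) := by
    intro B B' hB hB' hd
    by_cases hBB : B = B'
    · rw [hBB]
    · refine hiff _ _ (hlink B hB).1 (hlink B' hB').1 (hlink B hB).2 (hlink B' hB').2 ?_
      rw [Pair.compat_split_iff]
      tauto
  have hall : ∀ B B' : Pair n, Disjoint A.1 B.1 → Disjoint A.1 B'.1 →
      (P (B.split hn) ↔ P (B'.split hn)) := by
    intro B B' hB hB'
    by_cases hd : Disjoint B.1 B'.1
    · obtain ⟨k, hk⟩ := B.nonempty
      obtain ⟨l, hl⟩ := B'.nonempty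
      have hkl : k ≠ l := by
        rintro rfl
        exact Finset.disjoint_left.1 hd hk hl
      have hA : Disjoint A.1 (Pair.mk hkl).1 := by
        rw [Finset.disjoint_right]
        intro x hx
        rcases (Pair.mem_mk hkl).1 hx with rfl | rfl
        · exact Finset.disjoint_right.1 hB hk
        · exact Finset.disjoint_right.1 hB' hl
      refine (hmeet B _ hB hA ?_).trans (hmeet _ B' hA hB' ?_)
      · exact Finset.not_disjoint_iff.2 ⟨k, hk, (Pair.mem_mk hkl).2 (Or.inl rfl)⟩
      · exact Finset.not_disjoint_iff.2 ⟨l, (Pair.mem_mk hkl).2 (Or.inr rfl), hl⟩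
    · exact hmeet B B' hB hB' hd
  have hex : ∀ t : Split n, t ≠ A.split hn → Compat (A.split hn).1 t.1 →
      ∃ B : Pair n, Disjoint A.1 B.1 ∧ (P t ↔ P (B.split hn)) := by
    intro t ht hst
    obtain ⟨i, hi⟩ := A.nonempty
    have hA := (Pair.compat_iff hn A t).1 hst
    -- `t` does not cut `A` and differs from its split, so the part containing `A` has a further leg
    -- `k`. With `l` in the other part, the pair of `k` and `l` is cut by `t` and disjoint from `A`.
    obtain ⟨k, hk, hki⟩ : ∃ k, k ∉ A.1 ∧ t.1 k i := by
      by_contra! hcon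
      have key : ∀ k, t.1 k i ↔ k ∈ A.1 := fun k =>
        ⟨fun h => by by_contra h'; exact hcon k h' h, fun h => hA k h i hi⟩
      refine ht (Subtype.ext (Setoid.ext fun a b => ?_))
      rw [Pair.split_rel, ← key, ← key]
      constructor
      · intro h
        exact ⟨fun h' => t.1.trans (t.1.symm h) h', fun h' => t.1.trans h h'⟩
      · intro h
        by_cases ha : t.1 a i
        · exact t.1.trans ha (t.1.symm (h.1 ha))
        · exact t.rel_of_not_rel ha fun hb => ha (h.2 hb)
    obtain ⟨l, hl⟩ := t.exists_not_rel i
    have hkl : k ≠ l := by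
      rintro rfl
      exact hl hki
    have hd : Disjoint A.1 (Pair.mk hkl).1 := by
      rw [Finset.disjoint_right]
      intro x hx
      rcases (Pair.mem_mk hkl).1 hx with rfl | rfl
      · exact hk
      · exact fun h => hl (hA _ h i hi)
    refine ⟨_, hd, hiff _ _ ht (hlink _ hd).1 hst (hlink _ hd).2 fun hcon => ?_⟩
    have := (Pair.compat_mk_iff hn hkl t).1 hcon.symm
    exact hl (t.1.trans (t.1.symm this) hki)
  obtain ⟨B, hB, hPB⟩ := hex a ha hsa
  obtain ⟨B', hB', hPB'⟩ := hex b hb hsb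
  exact hPb (hPB'.2 ((hall B B' hB hB').1 (hPB.1 hPa)))

theorem exists_pair_image (hn : 5 ≤ n) {π : Equiv.Perm (Split n)}
    (hπ : ∀ s t : Split n, Compat (π s).1 (π t).1 ↔ Compat s.1 t.1) (A : Pair n) :
    ∃ B : Pair n, π (A.split hn) = B.split hn := by
  by_contra! hcon
  exact A.not_linkIsJoin hn (LinkIsJoin.of_perm hπ (linkIsJoin_of_forall_ne hn hcon))

/-- A map of pairs that preserves and reflects disjointness maps stars to stars. -/
theorem exists_star (hn : 5 ≤ n) {E : Pair n → Pair n} (hE : Function.Injective E)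
    (hd : ∀ A B : Pair n, A ≠ B → (Disjoint (E A).1 (E B).1 ↔ Disjoint A.1 B.1)) (i : Fin n) :
    ∃ a, ∀ A : Pair n, i ∈ A.1 → a ∈ (E A).1 := by
  have hmeet : ∀ A B : Pair n, i ∈ A.1 → i ∈ B.1 → ∃ a, a ∈ (E A).1 ∧ a ∈ (E B).1 := by
    intro A B hA hB
    by_cases hAB : A = B
    · subst hAB
      obtain ⟨a, ha⟩ := (E A).nonempty
      exact ⟨a, ha, ha⟩
    · refine Finset.not_disjoint_iff.1 fun h => ?_
      exact Finset.disjoint_left.1 ((hd A B hAB).1 h) hA hB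
  have hmem : ∀ {j} (h : i ≠ j), i ∈ (Pair.mk h).1 := fun h => (Pair.mem_mk h).2 (Or.inl rfl)
  have hinj : ∀ {j k} (h : i ≠ j) (h' : i ≠ k), Pair.mk h = Pair.mk h' → j = k := by
    intro j k h h' heq
    have h1 := (Pair.mem_mk (k := j) h).2 (Or.inr rfl)
    rw [heq, Pair.mem_mk] at h1
    exact h1.resolve_left h.symm
  obtain ⟨j, hj⟩ := exists_notMem_of_card_lt {i} (by simp; omega)
  rw [Finset.mem_singleton] at hj
  obtain ⟨k, hk⟩ := exists_notMem_of_card_lt {i, j}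
    (Finset.card_le_two.trans_lt (by omega))
  simp only [Finset.mem_insert, Finset.mem_singleton, not_or] at hk
  have hij : i ≠ j := Ne.symm hj
  have hik : i ≠ k := Ne.symm hk.1
  obtain ⟨a, ha1, ha2⟩ := hmeet _ _ (hmem hij) (hmem hik)
  obtain ⟨b, hab, hb⟩ := Pair.exists_eq_mk ha1
  obtain ⟨c, hac, hc⟩ := Pair.exists_eq_mk ha2
  have hbc : b ≠ c := by
    rintro rfl
    exact hk.2 (hinj hik hij (hE (hc.trans hb.symm)))
  -- An image that avoids `a` still meets both chosen images, so it closes them to a triangle.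
  have hcontra : ∀ A : Pair n, i ∈ A.1 → a ∉ (E A).1 → E A = Pair.mk hbc := by
    intro A hA haA
    refine Pair.eq_mk ?_ ?_ hbc
    · obtain ⟨x, hx, hx'⟩ := hmeet _ _ hA (hmem hij)
      rw [hb, Pair.mem_mk] at hx'
      rcases hx' with rfl | rfl
      · exact absurd hx haA
      · exact hx
    · obtain ⟨x, hx, hx'⟩ := hmeet _ _ hA (hmem hik)
      rw [hc, Pair.mem_mk] at hx'
      rcases hx' with rfl | rfl
      · exact absurd hx haA
      · exact hx
  refine ⟨a, fun A hA => ?_⟩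
  by_contra haA
  have hEA := hcontra A hA haA
  obtain ⟨l, hil, rfl⟩ := Pair.exists_eq_mk hA
  -- A triangle has three edges, but the star of `i` has at least four. The fifth leg `m` supplies
  -- an edge whose image has no room left.
  obtain ⟨m, hm⟩ := exists_notMem_of_card_lt {i, j, k, l}
    (Finset.card_le_four.trans_lt (by omega))
  simp only [Finset.mem_insert, Finset.mem_singleton, not_or] at hm
  have him : i ≠ m := Ne.symm hm.1
  by_cases ha : a ∈ (E (Pair.mk him)).1
  · obtain ⟨x, hx, hx'⟩ := hmeet _ _ (hmem him) (hmem hil)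
    rw [hEA, Pair.mem_mk] at hx'
    rcases hx' with rfl | rfl
    · exact hm.2.1 (hinj him hij (hE ((Pair.eq_mk ha hx hab).trans hb.symm)))
    · exact hm.2.2.1 (hinj him hik (hE ((Pair.eq_mk ha hx hac).trans hc.symm)))
  · exact hm.2.2.2 (hinj him hil (hE ((hcontra _ (hmem him) ha).trans hEA.symm)))

/-- The compatibility graph of stable splits has no automorphisms but permutations of the legs. -/
theorem exists_eq_permute (hn : 5 ≤ n) {π : Equiv.Perm (Split n)}
    (hπ : ∀ s t : Split n, Compat (π s).1 (π t).1 ↔ Compat s.1 t.1) :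
    ∃ σ : Equiv.Perm (Fin n), ∀ s, π s = s.permute σ := by
  choose E hE using exists_pair_image hn hπ
  have hEinj : Function.Injective E := fun A B h => Pair.split_injective hn <| π.injective <| by
    rw [hE, hE, h]
  have hd : ∀ A B : Pair n, A ≠ B → (Disjoint (E A).1 (E B).1 ↔ Disjoint A.1 B.1) := by
    intro A B hAB
    have h := hπ (A.split hn) (B.split hn)
    rw [hE, hE, Pair.compat_split_iff, Pair.compat_split_iff] at h
    simpa [hAB, hEinj.ne hAB] using h
  choose σ hσ using exists_star hn hEinj hd
  have hσinj : Function.Injective σ := by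
    intro i j h
    by_contra hij
    -- If `σ i = σ j`, the disjoint pairs of `i, k` and of `j, l` would have images sharing that
    -- leg.
    obtain ⟨k, hk⟩ := exists_notMem_of_card_lt {i, j}
      (Finset.card_le_two.trans_lt (by omega))
    obtain ⟨l, hl⟩ := exists_notMem_of_card_lt {i, j, k}
      (Finset.card_le_three.trans_lt (by omega))
    simp only [Finset.mem_insert, Finset.mem_singleton, not_or] at hk hl
    have hik : i ≠ k := Ne.symm hk.1
    have hjl : j ≠ l := Ne.symm hl.2.1
    have hdisj : Disjoint (Pair.mk hik).1 (Pair.mk hjl).1 := by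
      rw [Finset.disjoint_left]
      intro x hx hx'
      rw [Pair.mem_mk] at hx hx'
      rcases hx with rfl | rfl <;> rcases hx' with h1 | h1
      · exact hij h1
      · exact hl.1 h1.symm
      · exact hk.2 h1
      · exact hl.2.2 h1.symm
    have hne : Pair.mk hik ≠ Pair.mk hjl := by
      intro h1
      rw [h1, disjoint_self, Finset.bot_eq_empty] at hdisj
      exact (Pair.mk hjl).nonempty.ne_empty hdisj
    have h1 := hσ i _ ((Pair.mem_mk hik).2 (Or.inl rfl))
    have h2 := hσ j _ ((Pair.mem_mk hjl).2 (Or.inl rfl))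
    rw [h] at h1
    exact Finset.disjoint_left.1 ((hd _ _ hne).2 hdisj) h1 h2
  let τ : Equiv.Perm (Fin n) := Equiv.ofBijective σ (Finite.injective_iff_bijective.1 hσinj)
  refine ⟨τ, fun s => Subtype.ext (Setoid.ext fun x y => ?_)⟩
  obtain ⟨i, rfl⟩ := τ.surjective x
  obtain ⟨j, rfl⟩ := τ.surjective y
  rw [Split.permute_rel]
  by_cases hij : i = j
  · subst hij
    exact iff_of_true ((π s).1.refl _) (s.1.refl _)
  -- A split relates `i` and `j` exactly when it is compatible with the split of that pair, so the
  -- action on pairs determines the action on all splits.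
  · have h1 := hπ ((Pair.mk hij).split hn) s
    rw [hE, Pair.eq_mk (hσ i _ ((Pair.mem_mk hij).2 (Or.inl rfl)))
      (hσ j _ ((Pair.mem_mk hij).2 (Or.inr rfl))) (hσinj.ne hij), Pair.compat_mk_iff,
      Pair.compat_mk_iff] at h1
    exact h1

/-- Permutations of the legs that fix all stable splits are trivial. -/
theorem eq_one_of_permute_eq (hn : 5 ≤ n) {σ : Equiv.Perm (Fin n)}
    (h : ∀ s : Split n, s.permute σ = s) : σ = 1 := by
  -- Every pair is preserved by `σ`, and a leg is the intersection of two pairs containing it.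
  have hpair : ∀ {i j} (hij : i ≠ j), σ i = i ∨ σ i = j := by
    intro i j hij
    have h1 : ((Pair.mk hij).split hn).permute σ = (Pair.mk (σ.injective.ne hij)).split hn := by
      refine Subtype.ext (Setoid.ext fun x y => ?_)
      obtain ⟨x, rfl⟩ := σ.surjective x
      obtain ⟨y, rfl⟩ := σ.surjective y
      rw [Split.permute_rel, Pair.split_rel, Pair.split_rel]
      simp only [Pair.mem_mk, σ.injective.eq_iff]
    rw [h] at h1
    rw [← Pair.mem_mk hij, Pair.split_injective hn h1, Pair.mem_mk]
    exact Or.inl rfl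
  ext i
  obtain ⟨j, hj⟩ := exists_notMem_of_card_lt {i} (by simp; omega)
  obtain ⟨k, hk⟩ := exists_notMem_of_card_lt {i, j}
    (Finset.card_le_two.trans_lt (by omega))
  simp only [Finset.mem_insert, Finset.mem_singleton, not_or] at hj hk
  rcases hpair (Ne.symm hj) with h1 | h1
  · rw [h1]; rfl
  · rcases hpair (Ne.symm hk.1) with h2 | h2
    · rw [h2]; rfl
    · exact absurd (h2.symm.trans h1) hk.2

end Compatibility

/-! ### Permutations of the splits of four legs -/

section Action

variable {n : ℕ}

/-- The action of the permutations of the legs on stable splits. -/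
def splitAction (n : ℕ) : Equiv.Perm (Fin n) →* Equiv.Perm (Split n) where
  toFun σ :=
    { toFun := Split.permute σ
      invFun := Split.permute σ⁻¹
      left_inv := fun s => Subtype.ext <| Setoid.ext fun i j => by
        change s.1 (σ.symm (σ i)) (σ.symm (σ j)) ↔ _
        simp
      right_inv := fun s => Subtype.ext <| Setoid.ext fun i j => by
        change s.1 (σ (σ.symm i)) (σ (σ.symm j)) ↔ _
        simp }
  map_one' := rfl
  map_mul' _ _ := rfl

theorem splitAction_apply (σ : Equiv.Perm (Fin n)) (s : Split n) :
    splitAction n σ s = s.permute σ := rfl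

theorem splitAction_eq_one_iff (σ : Equiv.Perm (Fin n)) :
    splitAction n σ = 1 ↔ ∀ s : Split n, s.permute σ = s :=
  Equiv.ext_iff

/-- The part of a split of four legs that contains the leg `0`. -/
def sideOfZero (k : Fin 3) (i : Fin 4) : Bool := decide (i = 0 ∨ i = k.succ)

theorem exists_eq_sideOfZero : ∀ h : Fin 4 → Bool,
    (∀ b, ∃ i j, i ≠ j ∧ h i = b ∧ h j = b) →
      ∃ k, ∀ i j, h i = h j ↔ sideOfZero k i = sideOfZero k j := by
  decide

theorem balanced_sideOfZero : ∀ k b, ∃ i j, i ≠ j ∧ sideOfZero k i = b ∧ sideOfZero k j = b := by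
  decide

theorem sideOfZero_injective : ∀ k l,
    (∀ i j, sideOfZero k i = sideOfZero k j ↔ sideOfZero l i = sideOfZero l j) → k = l := by
  decide

theorem mem_kleinFour_iff : ∀ σ : Equiv.Perm (Fin 4),
    (∀ k i j, sideOfZero k (σ i) = sideOfZero k (σ j) ↔ sideOfZero k i = sideOfZero k j) ↔
      (σ = 1 ∨ σ = Equiv.swap 0 1 * Equiv.swap 2 3 ∨ σ = Equiv.swap 0 2 * Equiv.swap 1 3 ∨
        σ = Equiv.swap 0 3 * Equiv.swap 1 2) := by
  decide

/-- The three splits of four legs. -/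
def splitFour (k : Fin 3) : Split 4 := ⟨Setoid.ker (sideOfZero k), _, rfl, balanced_sideOfZero k⟩

theorem splitFour_bijective : Function.Bijective splitFour := by
  constructor
  · intro k l h
    exact sideOfZero_injective k l fun i j => Setoid.ext_iff.1 (congrArg Subtype.val h) i j
  · rintro ⟨_, g, rfl, hg⟩
    obtain ⟨k, hk⟩ := exists_eq_sideOfZero g hg
    exact ⟨k, Subtype.ext (Setoid.ext fun i j => (hk i j).symm)⟩

theorem Split.permute_eq_iff (σ : Equiv.Perm (Fin n)) (s t : Split n) :
    s.permute σ = t ↔ ∀ i j, t.1 (σ i) (σ j) ↔ s.1 i j := by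
  constructor
  · rintro rfl i j
    exact s.permute_rel σ i j
  · intro h
    refine Subtype.ext (Setoid.ext fun x y => ?_)
    obtain ⟨i, rfl⟩ := σ.surjective x
    obtain ⟨j, rfl⟩ := σ.surjective y
    rw [s.permute_rel, h]

theorem splitAction_four_eq_one_iff (σ : Equiv.Perm (Fin 4)) :
    splitAction 4 σ = 1 ↔ σ ∈ kleinFour := by
  rw [splitAction_eq_one_iff, splitFour_bijective.surjective.forall]
  simp only [Split.permute_eq_iff]
  exact mem_kleinFour_iff σ

/-- A split of four legs is named by the partner of the leg `0`. Fixing `0` and permuting the other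
three legs realises every permutation of the splits. -/
theorem splitAction_four_surjective : Function.Surjective (splitAction 4) := by
  intro π
  let ε : Fin 3 ≃ Split 4 := Equiv.ofBijective splitFour splitFour_bijective
  let ρ : Equiv.Perm (Fin 3) := (ε.trans π).trans ε.symm
  refine ⟨Equiv.Perm.decomposeFin.symm (0, ρ), Equiv.ext fun s => ?_⟩
  obtain ⟨k, rfl⟩ := splitFour_bijective.surjective s
  have h1 : π (splitFour k) = splitFour (ρ k) := (ε.apply_symm_apply _).symm
  have key : ∀ i, sideOfZero (ρ k) (Equiv.Perm.decomposeFin.symm (0, ρ) i) = sideOfZero k i := by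
    intro i
    refine Fin.cases ?_ (fun x => ?_) i
    · simp [sideOfZero]
    · simp [sideOfZero]
  rw [h1, splitAction_apply, Split.permute_eq_iff]
  intro i j
  change sideOfZero _ _ = sideOfZero _ _ ↔ sideOfZero _ _ = sideOfZero _ _
  rw [key, key]

theorem exists_mulEquiv_comp_eq {G A B : Type} [Group G] [Group A] [Group B] {φ : G →* A}
    {ψ : G →* B} (hφ : Function.Surjective φ) (hψ : Function.Surjective ψ)
    (h : φ.ker = ψ.ker) : ∃ e : A ≃* B, e.toMonoidHom.comp φ = ψ := by
  let e := (QuotientGroup.quotientKerEquivOfSurjective φ hφ).symm.trans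
    ((QuotientGroup.quotientMulEquivOfEq h).trans
      (QuotientGroup.quotientKerEquivOfSurjective ψ hψ))
  refine ⟨e, MonoidHom.ext fun g => ?_⟩
  have h1 : (QuotientGroup.quotientKerEquivOfSurjective φ hφ).symm (φ g) = (g : G ⧸ φ.ker) := by
    rw [MulEquiv.symm_apply_eq]
    rfl
  simp only [e, MulEquiv.toMonoidHom_eq_coe, MonoidHom.comp_apply, MonoidHom.coe_coe,
    MulEquiv.trans_apply, h1]
  rfl

end Action

/-! ### Automorphisms -/

section Automorphisms

variable {n : ℕ} {R : Type} [CommSemiring R] [CharZero R]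

/-- The combinatorial input is isolated as `H`, so that the argument serves `n ≥ 5` and `n = 4` and
both coefficient semirings. -/
theorem IsNatLinear.exists_permuteHom_eq
    (H : ∀ π : Equiv.Perm (Split n), (∀ s t : Split n, Compat (π s).1 (π t).1 ↔ Compat s.1 t.1) →
      ∃ σ : Equiv.Perm (Fin n), ∀ s, π s = s.permute σ)
    {f : Equiv.Perm (Moduli R n)} (hf : IsNatLinear f) (hf' : IsNatLinear f.symm) :
    ∃ σ, permuteHom R n σ = f := by
  obtain ⟨π, hπ⟩ := hf.exists_perm hf'
  obtain ⟨σ, hσ⟩ := H π fun s t => ⟨fun h => hf'.compat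
    (by rw [← hπ, Equiv.symm_apply_apply]) (by rw [← hπ, Equiv.symm_apply_apply]) h,
    fun h => hf.compat (hπ s) (hπ t) h⟩
  refine ⟨σ, DFunLike.coe_injective ?_⟩
  refine (isNatLinear_permuteMap σ).ext hf fun s => ?_
  rw [permuteMap_point, hπ, hσ]

theorem permuteHom_eq_one_iff (σ : Equiv.Perm (Fin n)) :
    permuteHom R n σ = 1 ↔ splitAction n σ = 1 := by
  rw [splitAction_eq_one_iff, ← permuteMap_eq_id_iff (R := R)]
  exact ⟨fun h => congrArg DFunLike.coe h, fun h => DFunLike.coe_injective h⟩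

theorem IsConeComplexMap.isNatLinear {f : MTrop n → MTrop n} (hf : IsConeComplexMap f) :
    IsNatLinear f := by
  intro Γ
  obtain ⟨Γ', φ, hφ, h⟩ := hf.2 Γ
  obtain ⟨T, hT⟩ := isConeMorphism_iff.1 hφ
  refine ⟨Γ', T, fun x => ?_⟩
  rw [h]
  exact congrArg _ (funext (hT x))

/-- Surjectivity excludes faces at infinity. Some point maps to the apex, so its cone has no
infinite coordinate and is mapped linearly; thus the apex maps to itself. As every cone contains the
apex, no cone can have a coordinate that is constantly `∞`. -/
theorem IsExtConeComplexMap.isNatLinear {f : MTropBar n → MTropBar n}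
    (hf : IsExtConeComplexMap f) (hsurj : Function.Surjective f) : IsNatLinear f := by
  have hmat : ∀ Γ : StableTree n, ∃ (Γ' : StableTree n) (S : Set Γ'.Edge)
      (T : Γ'.Edge → Γ.Edge → ℕ),
      (∀ x, (∀ e' ∉ S, (f (Moduli.mk Γ x)).weight (Γ'.split e') =
        ∑ e, (T e' e : ℝ≥0∞) * x e) ∧ ∀ e' ∈ S, (f (Moduli.mk Γ x)).weight (Γ'.split e') = ⊤) ∧
      (S = ∅ → ∀ x, f (Moduli.mk Γ x) = Moduli.mk Γ' fun e' => ∑ e, (T e' e : ℝ≥0∞) * x e) := by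
    intro Γ
    obtain ⟨Γ', φ, hφ, h⟩ := hf.2 Γ
    obtain ⟨S, T, hT⟩ := isExtConeMorphism_iff.1 hφ
    refine ⟨Γ', {e' | e' ∈ S}, T, fun x => ⟨fun e' he' => ?_, fun e' he' => ?_⟩, fun hS x => ?_⟩
    · rw [h, Moduli.weight_mk, Γ'.weight_split, hT]
      exact if_neg he'
    · rw [h, Moduli.weight_mk, Γ'.weight_split, hT]
      exact if_pos he'
    · rw [h]
      refine congrArg _ (funext fun e' => ?_)
      rw [hT]
      exact if_neg fun he' => Set.notMem_empty e' (hS ▸ he')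
  have hzero : ∀ Γ Γ' : StableTree n,
      (Moduli.mk Γ fun _ => (0 : ℝ≥0∞)) = Moduli.mk Γ' fun _ => 0 := fun Γ Γ' =>
    Moduli.weight_injective ((weight_mk_zero Γ).trans (weight_mk_zero Γ').symm)
  intro Γ
  have hf0 : (f (Moduli.mk Γ fun _ => 0)).weight = 0 := by
    obtain ⟨⟨Γ₁, x⟩, hp⟩ := hsurj (Moduli.mk Γ fun _ => 0)
    change f (Moduli.mk Γ₁ x) = _ at hp
    obtain ⟨Γ', S, T, h1, h2⟩ := hmat Γ₁
    have hS : S = ∅ := by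
      refine Set.eq_empty_of_forall_notMem fun e' he' => ?_
      have h3 := (h1 x).2 e' he'
      rw [hp, weight_mk_zero] at h3
      exact ENNReal.zero_ne_top h3
    rw [hzero Γ Γ₁, h2 hS]
    simp only [mul_zero, Finset.sum_const_zero]
    exact weight_mk_zero Γ'
  obtain ⟨Γ', S, T, h1, h2⟩ := hmat Γ
  refine ⟨Γ', T, h2 (Set.eq_empty_of_forall_notMem fun e' he' => ?_)⟩
  have h3 := (h1 fun _ => 0).2 e' he'
  rw [hf0] at h3
  exact ENNReal.zero_ne_top h3

theorem legAction_eq_one_iff (σ : Equiv.Perm (Fin n)) :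
    legAction n σ = 1 ↔ splitAction n σ = 1 := by
  rw [← permuteHom_eq_one_iff (R := ℝ≥0)]
  exact Subtype.ext_iff

theorem legActionBar_eq_one_iff (σ : Equiv.Perm (Fin n)) :
    legActionBar n σ = 1 ↔ splitAction n σ = 1 := by
  rw [← permuteHom_eq_one_iff (R := ℝ≥0∞)]
  exact Subtype.ext_iff

theorem legAction_surjective
    (H : ∀ π : Equiv.Perm (Split n), (∀ s t : Split n, Compat (π s).1 (π t).1 ↔ Compat s.1 t.1) →
      ∃ σ : Equiv.Perm (Fin n), ∀ s, π s = s.permute σ) :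
    Function.Surjective (legAction n) := by
  rintro ⟨f, hf, hf'⟩
  obtain ⟨σ, hσ⟩ := IsNatLinear.exists_permuteHom_eq H hf.isNatLinear hf'.isNatLinear
  exact ⟨σ, Subtype.ext hσ⟩

theorem legActionBar_surjective
    (H : ∀ π : Equiv.Perm (Split n), (∀ s t : Split n, Compat (π s).1 (π t).1 ↔ Compat s.1 t.1) →
      ∃ σ : Equiv.Perm (Fin n), ∀ s, π s = s.permute σ) :
    Function.Surjective (legActionBar n) := by
  rintro ⟨f, hf, hf'⟩
  obtain ⟨σ, hσ⟩ := IsNatLinear.exists_permuteHom_eq H (hf.isNatLinear f.surjective)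
    (hf'.isNatLinear f.symm.surjective)
  exact ⟨σ, Subtype.ext hσ⟩

theorem exists_mulEquiv_of_five_le {A : Type} [Group A] (hn : 5 ≤ n)
    {φ : Equiv.Perm (Fin n) →* A} (hsurj : Function.Surjective φ)
    (hφ : ∀ σ, φ σ = 1 ↔ splitAction n σ = 1) :
    ∃ Φ : Equiv.Perm (Fin n) ≃* A, ∀ σ, Φ σ = φ σ := by
  refine ⟨MulEquiv.ofBijective φ ⟨(injective_iff_map_eq_one φ).2 fun σ h => ?_, hsurj⟩,
    fun σ => rfl⟩
  exact eq_one_of_permute_eq hn ((splitAction_eq_one_iff σ).1 ((hφ σ).1 h))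

/-- `φ` and `splitAction 4` are surjections with the same kernel, so `A` is identified with the
permutations of the three splits. -/
theorem exists_mulEquiv_perm_three {A : Type} [Group A] {φ : Equiv.Perm (Fin 4) →* A}
    (hsurj : Function.Surjective φ) (hφ : ∀ σ, φ σ = 1 ↔ splitAction 4 σ = 1) :
    ∃ e : A ≃* Equiv.Perm (Fin 3), Function.Surjective (e.toMonoidHom.comp φ) ∧
      ((e.toMonoidHom.comp φ).ker : Set (Equiv.Perm (Fin 4))) = kleinFour := by
  obtain ⟨e, he⟩ := exists_mulEquiv_comp_eq hsurj splitAction_four_surjective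
    (Subgroup.ext fun σ => by rw [MonoidHom.mem_ker, MonoidHom.mem_ker, hφ])
  let ε : Split 4 ≃ Fin 3 := (Equiv.ofBijective splitFour splitFour_bijective).symm
  refine ⟨e.trans ε.permCongrHom, ?_, ?_⟩
  · exact (e.trans ε.permCongrHom).surjective.comp hsurj
  · ext σ
    rw [SetLike.mem_coe, MonoidHom.mem_ker, ← splitAction_four_eq_one_iff, ← hφ]
    exact (e.trans ε.permCongrHom).map_eq_one_iff

end Automorphisms

end TropModuli

theorem mainTheorem1 :
    (∀ n : ℕ, 5 ≤ n →
      (∃ Φ : Equiv.Perm (Fin n) ≃* TropModuli.AutMTrop n,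
        ∀ σ, Φ σ = TropModuli.legAction n σ) ∧
      (∃ Φ : Equiv.Perm (Fin n) ≃* TropModuli.AutMTropBar n,
        ∀ σ, Φ σ = TropModuli.legActionBar n σ)) ∧
    (∃ e : TropModuli.AutMTrop 4 ≃* Equiv.Perm (Fin 3),
      Function.Surjective (e.toMonoidHom.comp (TropModuli.legAction 4)) ∧
      ((e.toMonoidHom.comp (TropModuli.legAction 4)).ker : Set (Equiv.Perm (Fin 4))) =
        TropModuli.kleinFour) ∧
    (∃ e : TropModuli.AutMTropBar 4 ≃* Equiv.Perm (Fin 3),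
      Function.Surjective (e.toMonoidHom.comp (TropModuli.legActionBar 4)) ∧
      ((e.toMonoidHom.comp (TropModuli.legActionBar 4)).ker : Set (Equiv.Perm (Fin 4))) =
        TropModuli.kleinFour) := by

  -- For four legs every permutation of the splits is induced by the legs, so compatibility plays no
  -- role.
  have H4 : ∀ π : Equiv.Perm (TropModuli.Split 4), ∃ σ : Equiv.Perm (Fin 4),
      ∀ s, π s = s.permute σ := fun π => by
    obtain ⟨σ, rfl⟩ := TropModuli.splitAction_four_surjective π
    exact ⟨σ, fun s => rfl⟩
  refine ⟨fun n hn => ⟨?_, ?_⟩, ?_, ?_⟩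
  · exact TropModuli.exists_mulEquiv_of_five_le hn
      (TropModuli.legAction_surjective fun _ => TropModuli.exists_eq_permute hn)
      TropModuli.legAction_eq_one_iff
  · exact TropModuli.exists_mulEquiv_of_five_le hn
      (TropModuli.legActionBar_surjective fun _ => TropModuli.exists_eq_permute hn)
      TropModuli.legActionBar_eq_one_iff
  · exact TropModuli.exists_mulEquiv_perm_three
      (TropModuli.legAction_surjective fun π _ => H4 π) TropModuli.legAction_eq_one_iff
  · exact TropModuli.exists_mulEquiv_perm_three
      (TropModuli.legActionBar_surjective fun π _ => H4 π) TropModuli.legActionBar_eq_one_iff
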